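/- **Lemma 1.2.** Let $g\ge 1$ and let $\Sigma_g$ be the closed orientable surface of genus $g$, realized as the closed unit disc with its boundary circle cut into $4g$ equal sides that are glued in pairs according to the word $\prod_{i=1}^g a_ib_ia_i^{-1}b_i^{-1}$. Fix its handle decomposition with one $0$-handle $H_0$, $2g$ $1$-handles (with union $H_1$) and one $2$-handle $H_2$, where $H_2$ is the concentric disc of radius $\tfrac12$, the $1$-handles are the bands outside the interior of $H_2$ across the middle thirds of the $2g$ pairs of glued sides, and $H_0$ is formed by the remaining sectors (closed) about the corners; thus $H_0\cup H_1$ is the closure of the complement of $H_2$. An *orientable $S^2$-bundle* over a space $B$ is a locally trivial fibre bundle over $B$ with fibre the round sphere $S^2$ and structure group $SO(3)$; an *isomorphism* of such bundles is a homeomorphism of total spaces over $\mathrm{id}_B$ that in the bundle charts has the form $(b,y)\mapsto(b,\alpha(b)y)$ with $\alpha$ continuous and $SO(3)$-valued. For a continuous $\phi:S^1\to SO(3)$ let $$\Sigma_g\ltimes_\phi S^2 \;=\; H_2\times S^2\;\cup_\phi\;(H_0\cup H_1)\times S^2$$ be obtained by clutching the two trivial bundles along $\partial H_2\cong S^1$,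 where $(u,y)\in\partial H_2\times S^2$ is identified with $(u,\phi(u)y)$; this is an orientable $S^2$-bundle over $\Sigma_g$. Then: 1. $\pi_1(SO(3))\cong\mathbb Z/2$. 2. If $[\phi]$ is nontrivial in $\pi_1(SO(3),\phi(1))$, then $\Sigma_g\ltimes_\phi S^2$ is not isomorphic to the trivial bundle $\Sigma_g\times S^2$; there is not even a homeomorphism $\Sigma_g\ltimes_\phi S^2\to\Sigma_g\times S^2$ that covers the identity of $\Sigma_g$. 3. If $[\phi]$ is nontrivial, then every orientable $S^2$-bundle over $\Sigma_g$ is isomorphic to $\Sigma_g\times S^2$ or to $\Sigma_g\ltimes_\phi S^2$. Hence there are, up to isomorphism, exactly two orientable $S^2$-bundles over $\Sigma_g$. -/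

import Mathlib

open Bundle Set

noncomputable section

/-! ### The rotation group and the two-sphere -/

/-- The rotation group `SO(3)`, with the topology of real matrices. -/
abbrev SO3 : Type := Matrix.specialOrthogonalGroup (Fin 3) ℝ

/-- The unit sphere of Euclidean three-space. -/
abbrev S2 : Type := Metric.sphere (0 : EuclideanSpace ℝ (Fin 3)) 1

theorem SO3.transpose_mul_self (A : SO3) : (A.1).transpose * A.1 = 1 := by
  have h := (Matrix.mem_specialOrthogonalGroup_iff.1 A.2).1
  exact (Matrix.mem_orthogonalGroup_iff' (Fin 3) ℝ).1 h

theorem SO3.continuous_inv : Continuous (fun A : SO3 => A⁻¹) := by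
  refine Continuous.subtype_mk (f := fun A : SO3 => (A.1).transpose) ?_ _
  exact continuous_subtype_val.matrix_transpose

/-- The rotation `A` applied to a point of the sphere. -/
def rotate (A : SO3) (y : S2) : S2 :=
  ⟨WithLp.toLp 2 (A.1.mulVec (y.1).ofLp), by
    have hy : ‖(y.1 : EuclideanSpace ℝ (Fin 3))‖ = 1 := mem_sphere_zero_iff_norm.1 y.2
    have h1 : (y.1).ofLp ⬝ᵥ (y.1).ofLp = 1 := by
      have := EuclideanSpace.real_norm_sq_eq y.1
      rw [hy] at this
      simp only [dotProduct]
      rw [one_pow] at this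
      exact (Finset.sum_congr rfl fun i _ => (sq _).symm).trans this.symm
    have h2 : A.1.mulVec (y.1).ofLp ⬝ᵥ A.1.mulVec (y.1).ofLp = 1 := by
      rw [Matrix.dotProduct_mulVec, Matrix.vecMul_mulVec, SO3.transpose_mul_self,
        Matrix.vecMul_one, h1]
    rw [mem_sphere_zero_iff_norm]
    have h3 := EuclideanSpace.real_norm_sq_eq (WithLp.toLp 2 (A.1.mulVec (y.1).ofLp))
    have h4 : ‖WithLp.toLp 2 (A.1.mulVec (y.1).ofLp)‖ ^ 2 = 1 := by
      refine h3.trans (Eq.trans ?_ h2)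
      exact Finset.sum_congr rfl fun i _ => sq _
    exact (pow_eq_one_iff_of_nonneg (norm_nonneg _) two_ne_zero).1 h4⟩

theorem rotate_one (y : S2) : rotate 1 y = y := by
  apply Subtype.ext
  simp [rotate]

theorem rotate_mul (A B : SO3) (y : S2) : rotate (A * B) y = rotate A (rotate B y) := by
  apply Subtype.ext
  simp [rotate, Matrix.mulVec_mulVec]

theorem rotate_inv_rotate (A : SO3) (y : S2) : rotate A⁻¹ (rotate A y) = y := by
  rw [← rotate_mul, inv_mul_cancel, rotate_one]

theorem rotate_rotate_inv (A : SO3) (y : S2) : rotate A (rotate A⁻¹ y) = y := by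
  rw [← rotate_mul, mul_inv_cancel, rotate_one]

theorem rotate_faithful {A B : SO3} (h : ∀ y, rotate A y = rotate B y) : A = B := by
  apply Subtype.ext
  ext i j
  have hj : (EuclideanSpace.single j (1 : ℝ) : EuclideanSpace ℝ (Fin 3)) ∈
      Metric.sphere (0 : EuclideanSpace ℝ (Fin 3)) 1 := by simp
  have := congrArg (fun z : S2 => z.1 i) (h ⟨_, hj⟩)
  simpa [rotate] using this

theorem continuous_rotate : Continuous (fun p : SO3 × S2 => rotate p.1 p.2) := by
  refine Continuous.subtype_mk ?_ _
  refine (PiLp.continuous_toLp 2 _).comp ?_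
  exact (continuous_subtype_val.comp continuous_fst).matrix_mulVec
    ((PiLp.continuous_ofLp 2 _).comp (continuous_subtype_val.comp continuous_snd))

/-- The loop `t ↦ φ (exp (2 π i t))` traced by a map from the circle to `SO(3)`. -/
def circleLoop (φ : C(Circle, SO3)) : Path (φ 1) (φ 1) where
  toFun t := φ (Circle.exp (2 * Real.pi * (t : ℝ)))
  continuous_toFun := by fun_prop
  source' := by simp
  target' := by simp

/-- The class of a map from the circle to `SO(3)` in the fundamental group of `SO(3)`. -/
def loopClass (φ : C(Circle, SO3)) : FundamentalGroup SO3 (φ 1) :=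
  FundamentalGroup.fromPath (Path.Homotopic.Quotient.mk (circleLoop φ))

/-! ### Orientable two-sphere bundles -/

/-- An orientable two-sphere bundle over `B`: a fibre bundle with fibre the two-sphere and
structure group `SO(3)`, given by an atlas of local trivializations whose transition functions are
continuous maps into `SO(3)`. -/
structure OrientableS2Bundle (B : Type) [TopologicalSpace B] where
  total : Type
  [topology : TopologicalSpace total]
  proj : total → B
  atlas : Set (Trivialization S2 proj)
  exists_mem_atlas : ∀ b, ∃ e ∈ atlas, b ∈ e.baseSet
  transition : ∀ e ∈ atlas, ∀ e' ∈ atlas, ∃ τ : B → SO3,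
    ContinuousOn τ (e.baseSet ∩ e'.baseSet) ∧
    ∀ x, proj x ∈ e.baseSet ∩ e'.baseSet → (e' x).2 = rotate (τ (proj x)) (e x).2

attribute [instance] OrientableS2Bundle.topology

namespace OrientableS2Bundle

variable {B : Type} [TopologicalSpace B]

/-- The two total spaces are homeomorphic by a homeomorphism that covers the identity of the base:
isomorphism of the underlying topological fibre bundles, with no condition on structure groups. -/
def FibreHomeomorphic (X Y : OrientableS2Bundle B) : Prop :=
  ∃ Ψ : X.total ≃ₜ Y.total, ∀ x, Y.proj (Ψ x) = X.proj x

/-- Isomorphism of bundles with structure group `SO(3)`: a homeomorphism of the total spaces that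
covers the identity of the base and that has, in any charts of the two atlases, the form
`(b, y) ↦ (b, α(b) y)` with `α` continuous and `SO(3)`-valued. -/
def Iso (X Y : OrientableS2Bundle B) : Prop :=
  ∃ Ψ : X.total ≃ₜ Y.total, (∀ x, Y.proj (Ψ x) = X.proj x) ∧
    ∀ e ∈ X.atlas, ∀ e' ∈ Y.atlas, ∃ α : B → SO3,
      ContinuousOn α (e.baseSet ∩ e'.baseSet) ∧
      ∀ x, X.proj x ∈ e.baseSet ∩ e'.baseSet → (e' (Ψ x)).2 = rotate (α (X.proj x)) (e x).2

theorem Iso.refl (X : OrientableS2Bundle B) : Iso X X :=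
  ⟨Homeomorph.refl _, fun _ => rfl, fun e he e' he' => X.transition e he e' he'⟩

theorem Iso.symm {X Y : OrientableS2Bundle B} (h : Iso X Y) : Iso Y X := by
  obtain ⟨Ψ, hp, h⟩ := h
  have hp' : ∀ y, X.proj (Ψ.symm y) = Y.proj y := fun y => by
    rw [← hp, Ψ.apply_symm_apply]
  refine ⟨Ψ.symm, hp', fun e he e' he' => ?_⟩
  obtain ⟨α, hα, hx⟩ := h e' he' e he
  refine ⟨fun b => (α b)⁻¹, ?_, fun y hy => ?_⟩
  · rw [inter_comm]
    exact SO3.continuous_inv.comp_continuousOn hα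
  · have := hx (Ψ.symm y) (by rw [hp']; exact hy.symm)
    rw [Ψ.apply_symm_apply, hp'] at this
    rw [this, rotate_inv_rotate]

theorem Iso.trans {X Y Z : OrientableS2Bundle B} (h : Iso X Y) (h' : Iso Y Z) : Iso X Z := by
  obtain ⟨Ψ, hp, h⟩ := h
  obtain ⟨Ξ, hq, h'⟩ := h'
  refine ⟨Ψ.trans Ξ, fun x => by simp [hp, hq], fun e he e'' he'' => ?_⟩
  choose c hc hbc using Y.exists_mem_atlas
  choose α hα hαx using fun b => h e he (c b) (hc b)
  choose β hβ hβx using fun b => h' (c b) (hc b) e'' he''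
  have key : ∀ b x, X.proj x ∈ e.baseSet ∩ e''.baseSet → X.proj x ∈ (c b).baseSet →
      (e'' (Ξ (Ψ x))).2 = rotate (β b (X.proj x) * α b (X.proj x)) (e x).2 := by
    intro b x hx hb
    rw [rotate_mul, ← hαx b x ⟨hx.1, hb⟩, hβx b (Ψ x) (by rw [hp]; exact ⟨hb, hx.2⟩), hp]
  refine ⟨fun b => β b b * α b b, ?_, fun x hx => key (X.proj x) x hx (hbc _)⟩
  intro b hb
  have hcont : ContinuousWithinAt (fun a => β b a * α b a) (e.baseSet ∩ e''.baseSet) b := by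
    have hopen : (c b).baseSet ∈ nhds b := (c b).open_baseSet.mem_nhds (hbc b)
    have h1 : ContinuousWithinAt (β b) (e.baseSet ∩ e''.baseSet) b := by
      refine ((hβ b) b ⟨hbc b, hb.2⟩).mono_of_mem_nhdsWithin ?_
      exact Filter.inter_mem (mem_nhdsWithin_of_mem_nhds hopen)
        (Filter.mem_of_superset self_mem_nhdsWithin inter_subset_right)
    have h2 : ContinuousWithinAt (α b) (e.baseSet ∩ e''.baseSet) b := by
      refine ((hα b) b ⟨hb.1, hbc b⟩).mono_of_mem_nhdsWithin ?_
      exact Filter.inter_mem (Filter.mem_of_superset self_mem_nhdsWithin inter_subset_left)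
        (mem_nhdsWithin_of_mem_nhds hopen)
    exact h1.mul h2
  refine hcont.congr_of_eventuallyEq ?_ rfl
  filter_upwards [self_mem_nhdsWithin,
    mem_nhdsWithin_of_mem_nhds ((c b).open_baseSet.mem_nhds (hbc b))] with a ha hab
  apply rotate_faithful
  intro y
  have hmem : (a, y) ∈ e.target := by rw [e.mem_target]; exact ha.1
  have hpr : X.proj (e.toOpenPartialHomeomorph.symm (a, y)) = a := e.proj_symm_apply hmem
  have hval : e (e.toOpenPartialHomeomorph.symm (a, y)) = (a, y) := e.apply_symm_apply hmem
  have k1 := key a (e.toOpenPartialHomeomorph.symm (a, y)) (by rw [hpr]; exact ha)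
    (by rw [hpr]; exact hbc a)
  have k2 := key b (e.toOpenPartialHomeomorph.symm (a, y)) (by rw [hpr]; exact ha)
    (by rw [hpr]; exact hab)
  rw [hpr, hval] at k1 k2
  exact k1.symm.trans k2

/-- Isomorphism of bundles is an equivalence relation. -/
def isoSetoid (B : Type) [TopologicalSpace B] : Setoid (OrientableS2Bundle B) :=
  ⟨Iso, Iso.refl, Iso.symm, Iso.trans⟩

/-- The isomorphism classes of orientable two-sphere bundles over `B`. -/
def IsoClasses (B : Type) [TopologicalSpace B] : Type 1 := Quotient (isoSetoid B)

/-- The global chart of the product. -/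
def productChart (B : Type) [TopologicalSpace B] :
    Trivialization S2 (Prod.fst : B × S2 → B) where
  toOpenPartialHomeomorph := OpenPartialHomeomorph.refl _
  baseSet := univ
  open_baseSet := isOpen_univ
  source_eq := by simp
  target_eq := by simp
  proj_toFun _ _ := rfl

/-- The trivial bundle `B × S²`. -/
def product (B : Type) [TopologicalSpace B] : OrientableS2Bundle B where
  total := B × S2
  proj := Prod.fst
  atlas := {productChart B}
  exists_mem_atlas b := ⟨productChart B, rfl, mem_univ b⟩
  transition := by
    rintro e rfl e' rfl
    exact ⟨fun _ => 1, continuousOn_const, fun x _ => (rotate_one _).symm⟩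

end OrientableS2Bundle

/-! ### The closed orientable surface of genus `g` with its handles -/

/-- The closed unit disc. -/
abbrev UnitDisc : Type := Metric.closedBall (0 : ℂ) 1

/-- The unit circle is cut into `4 g` sides of equal length; `circlePt g t` is the point reached
after `t` sides. -/
def circlePt (g : ℕ) (t : ℝ) : Circle := Circle.exp (2 * Real.pi * t / (4 * g))

/-- The side identifications of the `4 g`-gon with boundary word
`∏ j, a_j * b_j * a_j⁻¹ * b_j⁻¹`: for `c = 0` (sides `a_j`) and `c = 1` (sides `b_j`), side number
`4 j + c` is glued to side number `4 j + c + 2` with the opposite direction. -/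
def SideRel (g : ℕ) (z w : UnitDisc) : Prop :=
  ∃ (j : Fin g) (c : Fin 2), ∃ s ∈ Icc (0 : ℝ) 1,
    z.1 = circlePt g (4 * (j : ℕ) + (c : ℕ) + s) ∧
    w.1 = circlePt g (4 * (j : ℕ) + (c : ℕ) + 3 - s)

/-- The closed orientable surface of genus `g` (for `g ≥ 1`), as a quotient of the disc. -/
def Surface (g : ℕ) : Type := Quot (SideRel g)

instance (g : ℕ) : TopologicalSpace (Surface g) :=
  inferInstanceAs (TopologicalSpace (Quot (SideRel g)))

namespace Surface

variable (g : ℕ)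

/-- The class of a point of the disc. -/
def mk (z : UnitDisc) : Surface g := Quot.mk _ z

theorem continuous_mk : Continuous (mk g) := continuous_quot_mk

variable {g}

theorem norm_eq_of_sideRel {z w : UnitDisc} (h : SideRel g z w) : ‖z.1‖ = 1 ∧ ‖w.1‖ = 1 := by
  obtain ⟨j, c, s, -, hz, hw⟩ := h
  rw [hz, hw]
  exact ⟨Circle.norm_coe _, Circle.norm_coe _⟩

/-- The distance to the centre of the polygon. -/
def radius : Surface g → ℝ :=
  Quot.lift (fun z => ‖z.1‖) fun _ _ h =>
    (norm_eq_of_sideRel h).1.trans (norm_eq_of_sideRel h).2.symm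

@[simp] theorem radius_mk (z : UnitDisc) : radius (mk g z) = ‖z.1‖ := rfl

theorem continuous_radius : Continuous (radius : Surface g → ℝ) :=
  continuous_quot_lift _ (continuous_norm.comp continuous_subtype_val)

variable (g)

/-- The `2`-handle: the disc of radius one half about the centre of the polygon. -/
def H2 : Set (Surface g) := {x | radius x ≤ 1 / 2}

/-- The `0`-handle: outside the `2`-handle, the sectors about the corners of the polygon (which
are all the same point of the surface). -/
def H0 : Set (Surface g) :=
  {x | ∃ z : UnitDisc, x = mk g z ∧ 1 / 2 ≤ ‖z.1‖ ∧ ∃ k : ℕ, ∃ s ∈ Icc (-1 / 3 : ℝ) (1 / 3),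
    z.1 = ‖z.1‖ * circlePt g (k + s)}

/-- The `2 g` `1`-handles: outside the `2`-handle, the bands across the middle thirds of the two
sides `4 j + c` and `4 j + c + 2` that are glued to each other. -/
def H1 (j : Fin g) (c : Fin 2) : Set (Surface g) :=
  {x | ∃ z : UnitDisc, x = mk g z ∧ 1 / 2 ≤ ‖z.1‖ ∧ ∃ s ∈ Icc (1 / 3 : ℝ) (2 / 3),
    z.1 = ‖z.1‖ * circlePt g (4 * (j : ℕ) + (c : ℕ) + s) ∨
    z.1 = ‖z.1‖ * circlePt g (4 * (j : ℕ) + (c : ℕ) + 2 + s)}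

/-- The union of the `0`-handle and the `1`-handles (see `H01_eq`). -/
def H01 : Set (Surface g) := {x | 1 / 2 ≤ radius x}

theorem H01_eq (hg : 1 ≤ g) : H01 g = H0 g ∪ ⋃ (j : Fin g) (c : Fin 2), H1 g j c := by
  ext x
  constructor
  · obtain ⟨z, rfl⟩ := Quot.exists_rep x
    intro hx
    have hx' : 1 / 2 ≤ ‖z.1‖ := hx
    have hg0 : (0 : ℝ) < g := by exact_mod_cast hg
    obtain ⟨θ, h0, h1, hz⟩ : ∃ θ : ℝ, 0 ≤ θ ∧ θ < 2 * Real.pi ∧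
        z.1 = ‖z.1‖ * (Circle.exp θ : ℂ) := by
      have hza : z.1 = ‖z.1‖ * (Circle.exp z.1.arg : ℂ) := by
        rw [Circle.coe_exp, Complex.norm_mul_exp_arg_mul_I]
      have hp := Real.pi_pos
      by_cases ha : 0 ≤ z.1.arg
      · exact ⟨z.1.arg, ha, by linarith [Complex.arg_le_pi z.1], hza⟩
      · refine ⟨z.1.arg + 2 * Real.pi, by linarith [Complex.neg_pi_lt_arg z.1], by linarith, ?_⟩
        rw [Circle.exp_add, Circle.exp_two_pi, mul_one]
        exact hza
    have hp := Real.pi_pos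
    set t : ℝ := θ / (2 * Real.pi) * (4 * g) with ht
    have ht0 : 0 ≤ t := by positivity
    have ht1 : t < 4 * g := by
      have : θ / (2 * Real.pi) < 1 := by rw [div_lt_one (by positivity)]; exact h1
      calc t < 1 * (4 * g) := by rw [ht]; gcongr
        _ = _ := one_mul _
    have hzt : z.1 = ‖z.1‖ * (circlePt g t : ℂ) := by
      have : 2 * Real.pi * t / (4 * g) = θ := by rw [ht]; field_simp
      rw [circlePt, this]
      exact hz
    set k := ⌊t⌋₊ with hk
    have hk1 : (k : ℝ) ≤ t := Nat.floor_le ht0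
    have hk2 : t < k + 1 := Nat.lt_floor_add_one t
    have hk3 : k < 4 * g := by
      have : (k : ℝ) < ((4 * g : ℕ) : ℝ) := by push_cast; linarith
      exact_mod_cast this
    by_cases hs1 : t - k ≤ 1 / 3
    · left
      refine ⟨z, rfl, hx', k, t - k, ⟨by linarith, hs1⟩, ?_⟩
      rw [show (k : ℝ) + (t - k) = t by ring]
      exact hzt
    by_cases hs2 : 2 / 3 ≤ t - k
    · left
      refine ⟨z, rfl, hx', k + 1, t - k - 1, ⟨by linarith, by linarith⟩, ?_⟩
      rw [show ((k + 1 : ℕ) : ℝ) + (t - k - 1) = t by push_cast; ring]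
      exact hzt
    right
    refine mem_iUnion₂.2 ⟨⟨k / 4, by omega⟩, ⟨k % 2, by omega⟩, z, rfl, hx', t - k, ⟨by linarith, by linarith⟩, ?_⟩
    have hdec : k = 4 * (k / 4) + k % 2 ∨ k = 4 * (k / 4) + k % 2 + 2 := by omega
    rcases hdec with h | h
    · left
      have hR : (k : ℝ) = 4 * ((k / 4 : ℕ) : ℝ) + ((k % 2 : ℕ) : ℝ) := by exact_mod_cast h
      have : 4 * ((k / 4 : ℕ) : ℝ) + ((k % 2 : ℕ) : ℝ) + (t - k) = t := by rw [← hR]; ring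
      exact this.symm ▸ hzt
    · right
      have hR : (k : ℝ) = 4 * ((k / 4 : ℕ) : ℝ) + ((k % 2 : ℕ) : ℝ) + 2 := by exact_mod_cast h
      have : 4 * ((k / 4 : ℕ) : ℝ) + ((k % 2 : ℕ) : ℝ) + 2 + (t - k) = t := by rw [← hR]; ring
      exact this.symm ▸ hzt
  · rintro (⟨z, rfl, hz, -⟩ | h)
    · exact hz
    · rw [mem_iUnion₂] at h
      obtain ⟨j, c, z, rfl, hz, -⟩ := h
      exact hz

theorem isClosed_H2 : IsClosed (H2 g) := isClosed_le continuous_radius continuous_const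

theorem isClosed_H01 : IsClosed (H01 g) := isClosed_le continuous_const continuous_radius

theorem H01_union_H2 : H01 g ∪ H2 g = univ := by
  ext x
  simp only [H01, H2, mem_union, mem_ofPred_eq, mem_univ, iff_true]
  exact le_total _ _

theorem mem_H2_of_notMem_H01 {x : Surface g} (hx : x ∉ H01 g) : x ∈ H2 g :=
  (lt_of_not_ge (show ¬ (1 / 2 ≤ radius x) from hx)).le

/-- The attaching circle, the common boundary of the `2`-handle and of the union of the others. -/
def attach (u : Circle) : Surface g :=
  mk g ⟨(u : ℂ) / 2, by simp [Circle.norm_coe]; norm_num⟩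

theorem radius_attach (u : Circle) : radius (attach g u) = 1 / 2 := by
  simp [attach, Circle.norm_coe]

theorem attach_mem_H01 (u : Circle) : attach g u ∈ H01 g := (radius_attach g u).ge

theorem attach_mem_H2 (u : Circle) : attach g u ∈ H2 g := (radius_attach g u).le

theorem exists_attach {x : Surface g} (h1 : x ∈ H01 g) (h2 : x ∈ H2 g) :
    ∃ u, x = attach g u := by
  obtain ⟨z, rfl⟩ := Quot.exists_rep x
  have hz : ‖z.1‖ = 1 / 2 := le_antisymm h2 h1
  refine ⟨⟨2 * z.1, mem_sphere_zero_iff_norm.2 (by simp [hz])⟩, ?_⟩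
  refine congrArg (mk g) (Subtype.ext ?_)
  simp

/-- An auxiliary continuous function, which multiplies the position `z` by `1 - ‖z‖`. -/
def direction : Surface g → ℂ :=
  Quot.lift (fun z => ((1 - ‖z.1‖ : ℝ) : ℂ) * z.1) fun z w h => by
    simp [(norm_eq_of_sideRel h).1, (norm_eq_of_sideRel h).2]

theorem continuous_direction : Continuous (direction g) :=
  continuous_quot_lift _ (by fun_prop)

/-- The angular coordinate about the centre of the polygon. -/
def angle (x : Surface g) : Circle := Circle.exp (direction g x).arg

theorem angle_attach (u : Circle) : angle g (attach g u) = u := by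
  have h : direction g (attach g u) = ((1 / 4 : ℝ) : ℂ) * (u : ℂ) := by
    change ((1 - ‖(u : ℂ) / 2‖ : ℝ) : ℂ) * ((u : ℂ) / 2) = _
    rw [norm_div, Circle.norm_coe]
    norm_num
    ring
  rw [angle, h, Complex.arg_real_mul _ (by norm_num), Circle.exp_arg]

theorem continuousOn_angle : ContinuousOn (angle g) {x | 1 / 4 < radius x ∧ radius x < 1} := by
  have hne : ∀ x : Surface g, x ∈ {x : Surface g | 1 / 4 < radius x ∧ radius x < 1} →
      direction g x ≠ 0 := by
    intro x hx
    obtain ⟨z, rfl⟩ := Quot.exists_rep x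
    have h1 : 1 / 4 < ‖z.1‖ := hx.1
    have h2 : ‖z.1‖ < 1 := hx.2
    refine mul_ne_zero ?_ (norm_pos_iff.1 (by linarith))
    exact_mod_cast (sub_pos.2 h2).ne'
  have hind : Topology.IsInducing ((↑) : Circle → ℂ) := ⟨rfl⟩
  refine hind.continuousOn_iff.2 ?_
  have hc : ContinuousOn (fun x => direction g x / (‖direction g x‖ : ℂ))
      {x | 1 / 4 < radius x ∧ radius x < 1} := by
    refine ContinuousOn.div (continuous_direction g).continuousOn ?_ ?_
    · exact (Complex.continuous_ofReal.comp (continuous_direction g).norm).continuousOn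
    · intro x hx
      exact_mod_cast norm_ne_zero_iff.2 (hne x hx)
  refine hc.congr fun x hx => ?_
  change (Circle.exp (direction g x).arg : ℂ) = _
  rw [Circle.coe_exp, eq_div_iff (by exact_mod_cast norm_ne_zero_iff.2 (hne x hx)), mul_comm,
    Complex.norm_mul_exp_arg_mul_I]

end Surface

/-! ### Clutching -/

namespace Clutching

open Surface

variable (g : ℕ) (φ : C(Circle, SO3))

/-- Over the attaching circle, the point `y` of the fibre of `H2 × S²` over `attach u` is glued to
the point `φ(u) y` of the fibre of `(H0 ∪ H1) × S²`. -/
inductive Glue : (H01 g × S2) ⊕ (H2 g × S2) → (H01 g × S2) ⊕ (H2 g × S2) → Prop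
  | glue (u : Circle) (y : S2) :
      Glue (Sum.inr (⟨attach g u, attach_mem_H2 g u⟩, y))
        (Sum.inl (⟨attach g u, attach_mem_H01 g u⟩, rotate (φ u) y))

/-- The total space `H2 × S² ∪_φ (H0 ∪ H1) × S²`. -/
def Total : Type := Quot (Glue g φ)

instance : TopologicalSpace (Total g φ) := inferInstanceAs (TopologicalSpace (Quot (Glue g φ)))

/-- The inclusion of `(H0 ∪ H1) × S²`. -/
def inOne (p : H01 g × S2) : Total g φ := Quot.mk _ (Sum.inl p)

/-- The inclusion of `H2 × S²`. -/
def inTwo (p : H2 g × S2) : Total g φ := Quot.mk _ (Sum.inr p)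

theorem inTwo_eq_inOne (u : Circle) (y : S2) :
    inTwo g φ (⟨attach g u, attach_mem_H2 g u⟩, y) =
      inOne g φ (⟨attach g u, attach_mem_H01 g u⟩, rotate (φ u) y) :=
  Quot.sound (Glue.glue u y)

theorem continuous_inOne : Continuous (inOne g φ) := continuous_quot_mk.comp continuous_inl

theorem continuous_inTwo : Continuous (inTwo g φ) := continuous_quot_mk.comp continuous_inr

theorem exists_rep (x : Total g φ) : (∃ p, x = inOne g φ p) ∨ ∃ p, x = inTwo g φ p := by
  obtain ⟨p | p, rfl⟩ := Quot.exists_rep x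
  · exact Or.inl ⟨p, rfl⟩
  · exact Or.inr ⟨p, rfl⟩

/-- The projection to the surface. -/
def proj : Total g φ → Surface g :=
  Quot.lift (Sum.elim (fun p => p.1.1) (fun p => p.1.1)) (by rintro _ _ ⟨u, y⟩; rfl)

@[simp] theorem proj_inOne (p : H01 g × S2) : proj g φ (inOne g φ p) = p.1 := rfl

@[simp] theorem proj_inTwo (p : H2 g × S2) : proj g φ (inTwo g φ p) = p.1 := rfl

theorem continuous_proj : Continuous (proj g φ) :=
  continuous_quot_lift _ (by fun_prop)

/-- The charts of the clutched bundle: all local trivializations that are given over the two pieces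
by continuous maps into `SO(3)`. -/
def atlas : Set (Trivialization S2 (proj g φ)) :=
  {e | (∃ σ : Surface g → SO3, ContinuousOn σ (e.baseSet ∩ H01 g) ∧
      ∀ p : H01 g × S2, p.1.1 ∈ e.baseSet →
        (e (inOne g φ p)).2 = rotate (σ p.1) p.2) ∧
    (∃ σ : Surface g → SO3, ContinuousOn σ (e.baseSet ∩ H2 g) ∧
      ∀ p : H2 g × S2, p.1.1 ∈ e.baseSet →
        (e (inTwo g φ p)).2 = rotate (σ p.1) p.2)}

theorem continuousOn_of_pieces {X Y : Type*} [TopologicalSpace X] [TopologicalSpace Y] {f : X → Y}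
    {s C D : Set X} (hC : IsClosed C) (hD : IsClosed D) (hs : s ⊆ C ∪ D)
    (h1 : ContinuousOn f (s ∩ C)) (h2 : ContinuousOn f (s ∩ D)) : ContinuousOn f s := by
  have hs' : s = (s ∩ C) ∪ (s ∩ D) := by rw [← inter_union_distrib_left, inter_eq_left.2 hs]
  have aux : ∀ K : Set X, IsClosed K → ContinuousOn f (s ∩ K) →
      ∀ x ∈ s, ContinuousWithinAt f (s ∩ K) x := by
    intro K hK h x hx
    by_cases hxK : x ∈ K
    · exact h x ⟨hx, hxK⟩
    · refine continuousWithinAt_of_notMem_closure fun hcl => hxK ?_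
      exact hK.closure_subset_iff.2 inter_subset_right hcl
  intro x hx
  rw [hs']
  exact (aux C hC h1 x hx).union (aux D hD h2 x hx)

section Chart

variable {g φ} {U : Set (Surface g)} (σ₁ σ₂ : Surface g → SO3)

/-- The fibre coordinate that is given by `σ₁` and `σ₂` over the two pieces. -/
def coord (h : ∀ u, σ₁ (attach g u) * φ u = σ₂ (attach g u)) : Total g φ → S2 :=
  Quot.lift (Sum.elim (fun p => rotate (σ₁ p.1) p.2) (fun p => rotate (σ₂ p.1) p.2)) (by
    rintro _ _ ⟨u, y⟩
    simp only [Sum.elim_inr, Sum.elim_inl]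
    rw [← rotate_mul, h])

open Classical in
/-- The inverse of a chart. -/
def chartInv (b : Surface g × S2) : Total g φ :=
  if hb : b.1 ∈ H01 g then inOne g φ (⟨b.1, hb⟩, rotate (σ₁ b.1)⁻¹ b.2)
  else inTwo g φ (⟨b.1, mem_H2_of_notMem_H01 g hb⟩, rotate (σ₂ b.1)⁻¹ b.2)

theorem chartInv_of_mem_H01 (b : Surface g × S2) (hb : b.1 ∈ H01 g) :
    chartInv (φ := φ) σ₁ σ₂ b = inOne g φ (⟨b.1, hb⟩, rotate (σ₁ b.1)⁻¹ b.2) :=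
  dif_pos hb

theorem chartInv_of_mem_H2 (h : ∀ u, σ₁ (attach g u) * φ u = σ₂ (attach g u)) (b : Surface g × S2) (hb : b.1 ∈ H2 g) :
    chartInv (φ := φ) σ₁ σ₂ b = inTwo g φ (⟨b.1, hb⟩, rotate (σ₂ b.1)⁻¹ b.2) := by
  by_cases hb' : b.1 ∈ H01 g
  · rw [chartInv_of_mem_H01 _ _ _ hb']
    obtain ⟨x, y⟩ := b
    obtain ⟨u, rfl⟩ := exists_attach g hb' hb
    refine Eq.trans ?_ (inTwo_eq_inOne g φ u _).symm
    refine congrArg (inOne g φ) (Prod.ext rfl ?_)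
    change rotate _ y = rotate _ (rotate _ y)
    rw [← rotate_mul, ← h]
    congr 1
    group
  · exact dif_neg hb'

theorem continuousOn_chart (hU : IsOpen U) (h₁ : ContinuousOn σ₁ (U ∩ H01 g))
    (h₂ : ContinuousOn σ₂ (U ∩ H2 g))
    (h : ∀ u, σ₁ (attach g u) * φ u = σ₂ (attach g u)) :
    ContinuousOn (fun x => (proj g φ x, coord σ₁ σ₂ h x)) (proj g φ ⁻¹' U) := by
  refine (continuous_proj g φ).continuousOn.prodMk ?_
  have ho : IsOpen (proj g φ ⁻¹' U) := hU.preimage (continuous_proj g φ)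
  have hq : Topology.IsQuotientMap (Quot.mk (Glue g φ)) := isQuotientMap_quot_mk
  refine (hq.continuousOn_isOpen_iff ho).2 ?_
  have ho' := ho.preimage hq.continuous
  rintro (p | p) hp
  · refine ContinuousAt.continuousWithinAt ?_
    rw [← Topology.IsOpenEmbedding.inl.continuousAt_iff]
    have hc : ContinuousOn (fun p : H01 g × S2 => rotate (σ₁ p.1) p.2) {p | p.1.1 ∈ U} := by
      refine continuous_rotate.comp_continuousOn (ContinuousOn.prodMk ?_ continuousOn_snd)
      exact h₁.comp (f := fun p : H01 g × S2 => p.1.1)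
        (by fun_prop) fun p hp => ⟨hp, p.1.2⟩
    exact hc.continuousAt ((hU.preimage (by fun_prop :
      Continuous fun p : H01 g × S2 => p.1.1)).mem_nhds hp)
  · refine ContinuousAt.continuousWithinAt ?_
    rw [← Topology.IsOpenEmbedding.inr.continuousAt_iff]
    have hc : ContinuousOn (fun p : H2 g × S2 => rotate (σ₂ p.1) p.2) {p | p.1.1 ∈ U} := by
      refine continuous_rotate.comp_continuousOn (ContinuousOn.prodMk ?_ continuousOn_snd)
      exact h₂.comp (f := fun p : H2 g × S2 => p.1.1)
        (by fun_prop) fun p hp => ⟨hp, p.1.2⟩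
    exact hc.continuousAt ((hU.preimage (by fun_prop :
      Continuous fun p : H2 g × S2 => p.1.1)).mem_nhds hp)

theorem continuousOn_rotate_inv {σ : Surface g → SO3} {K : Set (Surface g)}
    (hσ : ContinuousOn σ (U ∩ K)) :
    ContinuousOn (fun b : Surface g × S2 => rotate (σ b.1)⁻¹ b.2)
      ((U ×ˢ univ) ∩ Prod.fst ⁻¹' K) := by
  have h1 : ContinuousOn (fun b : Surface g × S2 => σ b.1) ((U ×ˢ univ) ∩ Prod.fst ⁻¹' K) :=
    hσ.comp continuousOn_fst fun b hb => ⟨hb.1.1, hb.2⟩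
  have h2 : ContinuousOn (fun b : Surface g × S2 => (σ b.1)⁻¹) ((U ×ˢ univ) ∩ Prod.fst ⁻¹' K) :=
    SO3.continuous_inv.comp_continuousOn h1
  exact continuous_rotate.comp_continuousOn (h2.prodMk continuousOn_snd)

theorem continuousOn_chartInv (h₁ : ContinuousOn σ₁ (U ∩ H01 g))
    (h₂ : ContinuousOn σ₂ (U ∩ H2 g))
    (h : ∀ u, σ₁ (attach g u) * φ u = σ₂ (attach g u)) :
    ContinuousOn (chartInv (φ := φ) σ₁ σ₂) (U ×ˢ univ) := by
  have hfst : Continuous (Prod.fst : Surface g × S2 → Surface g) := continuous_fst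
  refine continuousOn_of_pieces ((isClosed_H01 g).preimage hfst) ((isClosed_H2 g).preimage hfst)
    (fun b _ => (H01_union_H2 g).ge (mem_univ b.1)) ?_ ?_
  · rw [continuousOn_iff_continuous_domRestrict]
    have hc : ContinuousOn (fun b : Surface g × S2 => rotate (σ₁ b.1)⁻¹ b.2)
        ((U ×ˢ univ) ∩ Prod.fst ⁻¹' H01 g) := continuousOn_rotate_inv h₁
    have hb : Continuous (fun b : ↥((U ×ˢ univ) ∩ Prod.fst ⁻¹' H01 g : Set (Surface g × S2)) =>
        (⟨b.1.1, b.2.2⟩ : H01 g)) :=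
      Continuous.subtype_mk (hfst.comp continuous_subtype_val) _
    have := (continuous_inOne g φ).comp (hb.prodMk hc.domRestrict)
    exact this.congr fun b => (chartInv_of_mem_H01 σ₁ σ₂ b.1 b.2.2).symm
  · rw [continuousOn_iff_continuous_domRestrict]
    have hc : ContinuousOn (fun b : Surface g × S2 => rotate (σ₂ b.1)⁻¹ b.2)
        ((U ×ˢ univ) ∩ Prod.fst ⁻¹' H2 g) := continuousOn_rotate_inv h₂
    have hb : Continuous (fun b : ↥((U ×ˢ univ) ∩ Prod.fst ⁻¹' H2 g : Set (Surface g × S2)) =>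
        (⟨b.1.1, b.2.2⟩ : H2 g)) :=
      Continuous.subtype_mk (hfst.comp continuous_subtype_val) _
    have := (continuous_inTwo g φ).comp (hb.prodMk hc.domRestrict)
    exact this.congr fun b => (chartInv_of_mem_H2 σ₁ σ₂ h b.1 b.2.2).symm

/-- The chart that is given by `σ₁` and `σ₂` over the two pieces. -/
def chart (hU : IsOpen U) (h₁ : ContinuousOn σ₁ (U ∩ H01 g))
    (h₂ : ContinuousOn σ₂ (U ∩ H2 g))
    (h : ∀ u, σ₁ (attach g u) * φ u = σ₂ (attach g u)) :
    Trivialization S2 (proj g φ) where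
  toFun x := (proj g φ x, coord σ₁ σ₂ h x)
  invFun := chartInv σ₁ σ₂
  source := proj g φ ⁻¹' U
  target := U ×ˢ univ
  map_source' _ hx := ⟨hx, mem_univ _⟩
  map_target' b hb := by
    change proj g φ (chartInv σ₁ σ₂ b) ∈ U
    by_cases hb' : b.1 ∈ H01 g
    · rw [chartInv_of_mem_H01 σ₁ σ₂ b hb']
      exact hb.1
    · rw [chartInv_of_mem_H2 σ₁ σ₂ h b (mem_H2_of_notMem_H01 g hb')]
      exact hb.1
  left_inv' x _ := by
    rcases exists_rep g φ x with ⟨p, rfl⟩ | ⟨p, rfl⟩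
    · refine (chartInv_of_mem_H01 σ₁ σ₂ (p.1.1, rotate (σ₁ p.1) p.2) p.1.2).trans ?_
      exact congrArg (inOne g φ) (Prod.ext rfl (rotate_inv_rotate _ _))
    · refine (chartInv_of_mem_H2 σ₁ σ₂ h (p.1.1, rotate (σ₂ p.1) p.2) p.1.2).trans ?_
      exact congrArg (inTwo g φ) (Prod.ext rfl (rotate_inv_rotate _ _))
  right_inv' b _ := by
    by_cases hb' : b.1 ∈ H01 g
    · rw [chartInv_of_mem_H01 σ₁ σ₂ b hb']
      exact Prod.ext rfl (rotate_rotate_inv _ _)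
    · rw [chartInv_of_mem_H2 σ₁ σ₂ h b (mem_H2_of_notMem_H01 g hb')]
      exact Prod.ext rfl (rotate_rotate_inv _ _)
  open_source := hU.preimage (continuous_proj g φ)
  open_target := hU.prod isOpen_univ
  continuousOn_toFun := continuousOn_chart σ₁ σ₂ hU h₁ h₂ h
  continuousOn_invFun := continuousOn_chartInv σ₁ σ₂ h₁ h₂ h
  baseSet := U
  open_baseSet := hU
  source_eq := rfl
  target_eq := rfl
  proj_toFun _ _ := rfl

theorem chart_mem_atlas (hU : IsOpen U) (h₁ : ContinuousOn σ₁ (U ∩ H01 g))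
    (h₂ : ContinuousOn σ₂ (U ∩ H2 g))
    (h : ∀ u, σ₁ (attach g u) * φ u = σ₂ (attach g u)) :
    chart σ₁ σ₂ hU h₁ h₂ h ∈ atlas g φ :=
  ⟨⟨σ₁, h₁, fun _ _ => rfl⟩, ⟨σ₂, h₂, fun _ _ => rfl⟩⟩

end Chart

theorem exists_mem_atlas (b : Surface g) : ∃ e ∈ atlas g φ, b ∈ e.baseSet := by
  by_cases hb : radius b < 1 / 2
  · have hU : IsOpen {x : Surface g | radius x < 1 / 2} :=
      isOpen_lt continuous_radius continuous_const
    refine ⟨_, chart_mem_atlas (fun x => (φ (angle g x))⁻¹) (fun _ => 1) hU ?_ continuousOn_const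
      (fun u => by rw [angle_attach, inv_mul_cancel]), hb⟩
    rintro x ⟨hx, hx'⟩
    exact absurd (show 1 / 2 ≤ radius x from hx') (not_le_of_gt hx)
  · have hU : IsOpen {x : Surface g | 1 / 4 < radius x} :=
      isOpen_lt continuous_const continuous_radius
    refine ⟨_, chart_mem_atlas (fun _ => 1) (fun x => φ (angle g x)) hU continuousOn_const ?_
      (fun u => by rw [angle_attach, one_mul]), ?_⟩
    · refine φ.continuous.comp_continuousOn ((continuousOn_angle g).mono ?_)
      rintro x ⟨hx, hx'⟩
      exact ⟨hx, lt_of_le_of_lt hx' (by norm_num)⟩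
    · change 1 / 4 < radius b
      linarith [not_lt.1 hb]

theorem transition (e : Trivialization S2 (proj g φ)) (he : e ∈ atlas g φ)
    (e' : Trivialization S2 (proj g φ)) (he' : e' ∈ atlas g φ) :
    ∃ τ : Surface g → SO3, ContinuousOn τ (e.baseSet ∩ e'.baseSet) ∧
      ∀ x, proj g φ x ∈ e.baseSet ∩ e'.baseSet →
        (e' x).2 = rotate (τ (proj g φ x)) (e x).2 := by
  classical
  obtain ⟨⟨σ₁, c₁, h₁⟩, ⟨σ₂, c₂, h₂⟩⟩ := he
  obtain ⟨⟨σ₁', c₁', h₁'⟩, ⟨σ₂', c₂', h₂'⟩⟩ := he'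
  set τ : Surface g → SO3 := fun b =>
    if b ∈ H01 g then σ₁' b * (σ₁ b)⁻¹ else σ₂' b * (σ₂ b)⁻¹ with hτ
  have k₁ : ∀ b ∈ H01 g, τ b = σ₁' b * (σ₁ b)⁻¹ := fun b hb => if_pos hb
  have k₂ : ∀ b ∈ H2 g, b ∈ e.baseSet ∩ e'.baseSet → τ b = σ₂' b * (σ₂ b)⁻¹ := by
    intro b hb hbU
    by_cases hb' : b ∈ H01 g
    · rw [k₁ b hb']
      obtain ⟨u, rfl⟩ := exists_attach g hb' hb
      have q : σ₂ (attach g u) = σ₁ (attach g u) * φ u := by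
        apply rotate_faithful
        intro y
        rw [rotate_mul]
        have := h₁ (⟨attach g u, attach_mem_H01 g u⟩, rotate (φ u) y) hbU.1
        rw [← inTwo_eq_inOne, h₂ _ hbU.1] at this
        exact this
      have q' : σ₂' (attach g u) = σ₁' (attach g u) * φ u := by
        apply rotate_faithful
        intro y
        rw [rotate_mul]
        have := h₁' (⟨attach g u, attach_mem_H01 g u⟩, rotate (φ u) y) hbU.2
        rw [← inTwo_eq_inOne, h₂' _ hbU.2] at this
        exact this
      rw [q, q']
      group
    · exact if_neg hb'
  refine ⟨τ, ?_, ?_⟩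
  · refine continuousOn_of_pieces (isClosed_H01 g) (isClosed_H2 g)
      (by rw [H01_union_H2]; exact subset_univ _) ?_ ?_
    · refine ContinuousOn.congr ?_ fun b hb => k₁ b hb.2
      exact (c₁'.mono fun b hb => ⟨hb.1.2, hb.2⟩).mul
        (SO3.continuous_inv.comp_continuousOn (c₁.mono fun b hb => ⟨hb.1.1, hb.2⟩))
    · refine ContinuousOn.congr ?_ fun b hb => k₂ b hb.2 hb.1
      exact (c₂'.mono fun b hb => ⟨hb.1.2, hb.2⟩).mul
        (SO3.continuous_inv.comp_continuousOn (c₂.mono fun b hb => ⟨hb.1.1, hb.2⟩))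
  · intro x hx
    rcases exists_rep g φ x with ⟨p, rfl⟩ | ⟨p, rfl⟩
    · rw [proj_inOne] at hx ⊢
      rw [k₁ _ p.1.2, h₁' p hx.2, h₁ p hx.1, ← rotate_mul]
      congr 1
      group
    · rw [proj_inTwo] at hx ⊢
      rw [k₂ _ p.1.2 hx, h₂' p hx.2, h₂ p hx.1, ← rotate_mul]
      congr 1
      group

end Clutching

/-- The bundle `Σ_g ⋉_φ S² = H2 × S² ∪_φ (H0 ∪ H1) × S²`. -/
def clutchedBundle (g : ℕ) (φ : C(Circle, SO3)) : OrientableS2Bundle (Surface g) where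
  total := Clutching.Total g φ
  proj := Clutching.proj g φ
  atlas := Clutching.atlas g φ
  exists_mem_atlas := Clutching.exists_mem_atlas g φ
  transition := Clutching.transition g φ

end

/-!
Write `spin : S3 → SO(3)` for the double cover by the unit quaternions. Since `S3` is simply
connected (`sphere_simplyConnected`), the fundamental group of `SO(3)` is the kernel `{1, -1}` of
`spin`. A loop in `SO(3)` has trivial class if and only if it is *even*, that is, it lifts to a
closed loop in `S3` (`loopClass_eq_one_iff`), and this happens if and only if it extends over the
disc. The lift of any loop closes up to a sign, so the product of two loops that are not even is
even. All three parts of the classification are reduced to parity.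

*Nontriviality.* Three distinct points of the sphere are never collinear, so the Gram-Schmidt
process gives a rotation `tripleFrame` that depends continuously and equivariantly on them. A
homeomorphism `Σ ⋉_φ S² ≃ Σ × S²` over the identity carries three constant sections to three
disjoint sections of the clutched bundle, whatever its behaviour on the fibres. Their frames over
`H0 ∪ H1` and over `H2` are maps `a`, `b` into `SO(3)` with `a = φ b` on the attaching circle. Here
`b` is even because `H2` is a disc. Also `a` is even (`evenLoop_attach_of_H01`): lift it to `S3` over
the annulus between the attaching circle and the boundary of the polygon. On two sides that are
glued the lifts agree up to a sign, and in the word `∏ a b a⁻¹ b⁻¹` each of these signs occurs twice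
(`lift_boundary_closed`). Hence `φ` is even. No knowledge of the homeomorphism group of the sphere
is needed.

*Classification.* A frame of a bundle is a section of its principal `SO(3)`-bundle; two frames over
the same map differ by a map into `SO(3)`. Every bundle has a frame over the polygon
(`exists_isFrame_disc`). As `SO(3)` is connected, there is a frame over the boundary that respects
the gluing of the sides (`exists_isFrame_boundary`), and it differs from the first one by a map `τ`
from the circle to `SO(3)`. Corrected by `τ`, the frame over the annulus descends to `H0 ∪ H1`.
Corrected by an extension of `τ φ` to the disc, which exists if `τ φ` is even, the frame over the disc
gives a frame over `H2`, and the two differ by `φ`: the bundle is the clutched bundle of `φ`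
(`exists_forall_iso_clutchedBundle`). If `τ` is even this applies to `φ = 1`, which gives the product,
and otherwise to every `φ` that is not even.
-/

/-! ### The double cover of the rotation group -/

open scoped Quaternion

/-- The group of unit quaternions, which is the three-sphere. -/
abbrev S3 : Type := Metric.sphere (0 : ℍ[ℝ]) 1

-- Shortcut instances: the general search on a sphere tries commutative structures first.
noncomputable instance : Group S3 := Metric.unitSphere.instGroup
noncomputable instance : MulOneClass S3 := Monoid.toMulOneClass
noncomputable instance : Mul S3 := MulOne.toMul

/-- The matrix of `v ↦ q v q*` on the imaginary quaternions, for a quaternion `q`. -/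
def conjMatrix (q : ℍ[ℝ]) : Matrix (Fin 3) (Fin 3) ℝ :=
  !![q.re ^ 2 + q.imI ^ 2 - q.imJ ^ 2 - q.imK ^ 2, 2 * (q.imI * q.imJ - q.re * q.imK),
      2 * (q.imI * q.imK + q.re * q.imJ);
    2 * (q.imI * q.imJ + q.re * q.imK), q.re ^ 2 - q.imI ^ 2 + q.imJ ^ 2 - q.imK ^ 2,
      2 * (q.imJ * q.imK - q.re * q.imI);
    2 * (q.imI * q.imK - q.re * q.imJ), 2 * (q.imJ * q.imK + q.re * q.imI),
      q.re ^ 2 - q.imI ^ 2 - q.imJ ^ 2 + q.imK ^ 2]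

theorem conjMatrix_one : conjMatrix 1 = 1 := by
  ext i j; fin_cases i <;> fin_cases j <;> simp [conjMatrix]

theorem conjMatrix_mul (p q : ℍ[ℝ]) : conjMatrix (p * q) = conjMatrix p * conjMatrix q := by
  ext i j
  fin_cases i <;> fin_cases j <;>
    simp [conjMatrix, Matrix.mul_apply, Fin.sum_univ_three] <;> ring

theorem mem_sphere_iff_sum_sq (q : ℍ[ℝ]) :
    q ∈ Metric.sphere (0 : ℍ[ℝ]) 1 ↔ q.re ^ 2 + q.imI ^ 2 + q.imJ ^ 2 + q.imK ^ 2 = 1 := by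
  rw [mem_sphere_zero_iff_norm, ← Quaternion.normSq_def', Quaternion.normSq_eq_norm_mul_self,
    ← sq, pow_eq_one_iff_of_nonneg (norm_nonneg q) two_ne_zero]

theorem S3.sum_sq (q : S3) : q.1.re ^ 2 + q.1.imI ^ 2 + q.1.imJ ^ 2 + q.1.imK ^ 2 = 1 :=
  (mem_sphere_iff_sum_sq q.1).1 q.2

theorem conjMatrix_mem (q : S3) : conjMatrix q.1 ∈ Matrix.specialOrthogonalGroup (Fin 3) ℝ := by
  have h := S3.sum_sq q
  rw [Matrix.mem_specialOrthogonalGroup_iff, Matrix.mem_orthogonalGroup_iff]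
  have h2 : (q.1.re ^ 2 + q.1.imI ^ 2 + q.1.imJ ^ 2 + q.1.imK ^ 2) ^ 2 = 1 := by rw [h, one_pow]
  have h3 : (q.1.re ^ 2 + q.1.imI ^ 2 + q.1.imJ ^ 2 + q.1.imK ^ 2) ^ 3 = 1 := by rw [h, one_pow]
  constructor
  · ext i j
    fin_cases i <;> fin_cases j <;>
      simp [conjMatrix, Matrix.mul_apply, Fin.sum_univ_three] <;> first | ring1 | linear_combination h2
  · rw [Matrix.det_fin_three]
    simp [conjMatrix]
    linear_combination h3

/-- The double cover of the rotation group by the unit quaternions. -/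
def spin : S3 →* SO3 where
  toFun q := ⟨conjMatrix q.1, conjMatrix_mem q⟩
  map_one' := Subtype.ext conjMatrix_one
  map_mul' p q := Subtype.ext (conjMatrix_mul p.1 q.1)

theorem continuous_spin : Continuous spin := by
  refine Continuous.subtype_mk (f := fun q : S3 => conjMatrix q.1) ?_ _
  refine continuous_matrix fun i j => ?_
  have h1 := Quaternion.continuous_re.comp (continuous_subtype_val (p := (· ∈ Metric.sphere (0 : ℍ[ℝ]) 1)))
  have h2 := Quaternion.continuous_imI.comp (continuous_subtype_val (p := (· ∈ Metric.sphere (0 : ℍ[ℝ]) 1)))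
  have h3 := Quaternion.continuous_imJ.comp (continuous_subtype_val (p := (· ∈ Metric.sphere (0 : ℍ[ℝ]) 1)))
  have h4 := Quaternion.continuous_imK.comp (continuous_subtype_val (p := (· ∈ Metric.sphere (0 : ℍ[ℝ]) 1)))
  simp only [Function.comp_def] at h1 h2 h3 h4
  fin_cases i <;> fin_cases j <;> simp [conjMatrix] <;> fun_prop

theorem spin_eq_one_iff (q : S3) : spin q = 1 ↔ q = 1 ∨ q = -1 := by
  have h := S3.sum_sq q
  constructor
  · intro hq
    have e : conjMatrix q.1 = 1 := congrArg Subtype.val hq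
    have e0 := congrFun (congrFun e 0) 0
    have e1 := congrFun (congrFun e 1) 1
    have e2 := congrFun (congrFun e 2) 2
    simp [conjMatrix] at e0 e1 e2
    have hI : q.1.imI = 0 := by nlinarith
    have hJ : q.1.imJ = 0 := by nlinarith
    have hK : q.1.imK = 0 := by nlinarith
    rw [hI, hJ, hK] at h
    have h' : q.1.re = 1 ∨ q.1.re = -1 := by
      rw [← sq_eq_one_iff]
      linarith
    refine h'.imp (fun h' => Subtype.ext ?_) fun h' => Subtype.ext ?_
    · ext <;> simp [h', hI, hJ, hK]
    · ext <;> simp [h', hI, hJ, hK]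
  · rintro (rfl | rfl)
    · exact map_one _
    · refine Subtype.ext ?_
      change conjMatrix _ = 1
      ext i j; fin_cases i <;> fin_cases j <;> simp [conjMatrix]

/-- The half-angle formulas. -/
theorem exists_half_angle {p s : ℝ} (h : p ^ 2 + s ^ 2 = 1) :
    ∃ a b : ℝ, a ^ 2 + b ^ 2 = 1 ∧ a ^ 2 - b ^ 2 = p ∧ 2 * (a * b) = s := by
  by_cases hp : p = -1
  · refine ⟨0, 1, by norm_num, by rw [hp]; norm_num, ?_⟩
    have : s ^ 2 = 0 := by rw [hp] at h; linarith
    rw [pow_eq_zero_iff two_ne_zero] at this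
    rw [this]; ring
  · have hp1 : 0 < (1 + p) / 2 := by
      have : -1 ≤ p := by nlinarith [sq_nonneg s]
      have := lt_of_le_of_ne this (Ne.symm hp)
      linarith
    obtain ⟨a, ha, ha2⟩ : ∃ a : ℝ, 0 < a ∧ a ^ 2 = (1 + p) / 2 :=
      ⟨√((1 + p) / 2), Real.sqrt_pos.2 hp1, Real.sq_sqrt hp1.le⟩
    have hb : (s / (2 * a)) ^ 2 = (1 - p) / 2 := by
      rw [div_pow, mul_pow, ha2, div_eq_iff (by positivity)]
      linear_combination h
    exact ⟨a, s / (2 * a), by rw [ha2, hb]; ring, by rw [ha2, hb]; ring, by field_simp⟩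

/-- Unit quaternions act transitively on the unit vectors; here the image of the first basis vector
is prescribed. -/
theorem exists_conjMatrix_col {x y z : ℝ} (h : x ^ 2 + y ^ 2 + z ^ 2 = 1) :
    ∃ q : S3, conjMatrix q.1 0 0 = x ∧ conjMatrix q.1 1 0 = y ∧ conjMatrix q.1 2 0 = z := by
  by_cases hx : x = -1
  · have hy : y = 0 := by rw [hx] at h; nlinarith
    have hz : z = 0 := by rw [hx] at h; nlinarith
    refine ⟨⟨⟨0, 0, 1, 0⟩, (mem_sphere_iff_sum_sq _).2 (by norm_num)⟩, ?_⟩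
    simp [conjMatrix, hx, hy, hz]
  · have hp1 : 0 < (1 + x) / 2 := by
      have : -1 ≤ x := by nlinarith [sq_nonneg y, sq_nonneg z]
      have := lt_of_le_of_ne this (Ne.symm hx)
      linarith
    obtain ⟨a, ha, ha2⟩ : ∃ a : ℝ, 0 < a ∧ a ^ 2 = (1 + x) / 2 :=
      ⟨√((1 + x) / 2), Real.sqrt_pos.2 hp1, Real.sq_sqrt hp1.le⟩
    have hb : (-z / (2 * a)) ^ 2 + (y / (2 * a)) ^ 2 = (1 - x) / 2 := by
      rw [div_pow, div_pow, mul_pow, ha2, ← add_div, div_eq_iff (by positivity)]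
      linear_combination h
    refine ⟨⟨⟨a, 0, -z / (2 * a), y / (2 * a)⟩, (mem_sphere_iff_sum_sq _).2 ?_⟩, ?_⟩
    · linear_combination ha2 + hb
    · refine ⟨?_, ?_, ?_⟩
      · simp only [conjMatrix, Matrix.of_apply, Matrix.cons_val', Matrix.cons_val_zero]
        linear_combination ha2 - hb
      · simp [conjMatrix]; field_simp
      · simp [conjMatrix]; field_simp

/-- A rotation that fixes the first basis vector is a conjugation by `a + b i`. -/
theorem exists_spin_eq_of_fix {A : SO3} (h0 : A.1 0 0 = 1) (h1 : A.1 1 0 = 0)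
    (h2 : A.1 2 0 = 0) : ∃ q, spin q = A := by
  have hr : A.1 * A.1.transpose = 1 :=
    (Matrix.mem_orthogonalGroup_iff (Fin 3) ℝ).1 (Matrix.mem_specialOrthogonalGroup_iff.1 A.2).1
  have hc := SO3.transpose_mul_self A
  have hd : A.1.det = 1 := (Matrix.mem_specialOrthogonalGroup_iff.1 A.2).2
  rw [Matrix.det_fin_three] at hd
  have r00 := congrFun (congrFun hr 0) 0
  have c11 := congrFun (congrFun hc 1) 1
  have c22 := congrFun (congrFun hc 2) 2
  simp [Matrix.mul_apply, Fin.sum_univ_three, h0] at r00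
  have h01 : A.1 0 1 = 0 := by nlinarith
  have h02 : A.1 0 2 = 0 := by nlinarith
  simp [Matrix.mul_apply, Fin.sum_univ_three, h01] at c11
  simp [Matrix.mul_apply, Fin.sum_univ_three, h02] at c22
  simp only [h0, h1, h2, h01, h02] at hd
  have hsum : (A.1 2 2 - A.1 1 1) ^ 2 + (A.1 1 2 + A.1 2 1) ^ 2 = 0 := by
    linear_combination c11 + c22 - 2 * hd
  have h22 : A.1 2 2 = A.1 1 1 := by nlinarith [sq_nonneg (A.1 2 2 - A.1 1 1), sq_nonneg (A.1 1 2 + A.1 2 1)]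
  have h12 : A.1 1 2 = -A.1 2 1 := by nlinarith [sq_nonneg (A.1 2 2 - A.1 1 1), sq_nonneg (A.1 1 2 + A.1 2 1)]
  obtain ⟨a, b, hab, hp, hs⟩ := exists_half_angle
    (show (A.1 1 1) ^ 2 + (A.1 2 1) ^ 2 = 1 by linear_combination c11)
  refine ⟨⟨⟨a, b, 0, 0⟩, (mem_sphere_iff_sum_sq _).2 (by simpa using hab)⟩, Subtype.ext ?_⟩
  change conjMatrix _ = A.1
  ext i j
  fin_cases i <;> fin_cases j <;> simp [conjMatrix, h0, h1, h2, h01, h02, h12, h22, hab, hp, hs]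

theorem spin_surjective : Function.Surjective spin := by
  intro A
  have hc := congrFun (congrFun (SO3.transpose_mul_self A) 0) 0
  simp [Matrix.mul_apply, Fin.sum_univ_three] at hc
  obtain ⟨q, h0, h1, h2⟩ := exists_conjMatrix_col
    (show (A.1 0 0) ^ 2 + (A.1 1 0) ^ 2 + (A.1 2 0) ^ 2 = 1 by linear_combination hc)
  have hq := SO3.transpose_mul_self (spin q)
  have key : ∀ i, ((spin q)⁻¹ * A).1 i 0 = (1 : Matrix (Fin 3) (Fin 3) ℝ) i 0 := by
    intro i
    rw [← hq]
    change ((spin q).1.transpose * A.1) i 0 = _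
    simp only [Matrix.mul_apply, Fin.sum_univ_three]
    rw [← h0, ← h1, ← h2]
    rfl
  obtain ⟨r, hr⟩ := exists_spin_eq_of_fix (A := (spin q)⁻¹ * A) (by simp [key]) (by simp [key])
    (by simp [key])
  exact ⟨q * r, by rw [map_mul, hr, mul_inv_cancel_left]⟩

theorem isQuotientMap_spin : Topology.IsQuotientMap spin :=
  continuous_spin.isClosedMap.isQuotientMap continuous_spin spin_surjective

theorem coe_ker_spin : (spin.ker : Set S3) = {1, -1} := by
  ext q
  simpa using spin_eq_one_iff q

theorem S3.neg_one_ne_one : (-1 : S3) ≠ 1 := by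
  intro h
  have := congrArg (fun q : S3 => q.1.re) h
  norm_num at this

theorem isQuotientCoveringMap_spin : IsQuotientCoveringMap spin spin.ker :=
  isQuotientMap_spin.isQuotientCoveringMap_of_isDiscrete_ker_monoidHom <| by
    rw [coe_ker_spin]
    exact (Set.toFinite _).isDiscrete

theorem isCoveringMap_spin : IsCoveringMap spin := isQuotientCoveringMap_spin.isCoveringMap

/-! ### The three-sphere is simply connected -/

section Sphere

variable {E : Type*} [NormedAddCommGroup E] [InnerProductSpace ℝ E]

/-- A loop on a sphere that misses a point is null-homotopic, by stereographic projection. -/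
theorem sphere_loop_homotopic_refl_of_notMem {x v : Metric.sphere (0 : E) 1} (γ : Path x x)
    (hv : ∀ t, γ t ≠ v) : γ.Homotopic (Path.refl x) := by
  have hv1 : ‖(v : E)‖ = 1 := mem_sphere_zero_iff_norm.1 v.2
  let s := stereographic hv1
  have hs : ∀ t, γ t ∈ s.source := fun t => by
    rw [stereographic_source]
    exact hv t
  have hσ : Continuous s.symm := by
    rw [← continuousOn_univ, ← stereographic_target hv1]
    exact s.continuousOn_invFun
  let δ : Path (s x) (s x) :=
    { toFun := fun t => s (γ t)
      continuous_toFun := s.continuousOn_toFun.comp_continuous γ.continuous hs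
      source' := by simp
      target' := by simp }
  have hx : s.symm (s x) = x := s.left_inv (by simpa using hs 0)
  have h := (SimplyConnectedSpace.paths_homotopic δ (Path.refl _)).map ⟨s.symm, hσ⟩
  obtain ⟨F⟩ := h
  refine ⟨(F.pathCast hx.symm hx.symm).cast (Path.ext (funext fun t => ?_))
    (Path.ext (funext fun _ => hx))⟩
  exact s.left_inv (hs t)

/-- A loop on a sphere of dimension at least two is homotopic to a loop that misses a point:
the radial projection of a smooth approximation. -/
theorem sphere_exists_homotopic_notMem [FiniteDimensional ℝ E] (hE : 2 < Module.finrank ℝ E)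
    {x : Metric.sphere (0 : E) 1} (γ : Path x x) :
    ∃ (γ' : Path x x) (v : Metric.sphere (0 : E) 1), γ.Homotopic γ' ∧ ∀ t, γ' t ≠ v := by
  have hc : Continuous (fun t : ℝ => (γ.extend t : E)) :=
    continuous_subtype_val.comp γ.continuous_extend
  obtain ⟨g, hg, hd, -⟩ := hc.exists_contDiff_approx 1 (ε := fun _ => 1 / 4) continuous_const
    (fun _ => by norm_num)
  -- The approximation is corrected linearly, so that its endpoints are those of the loop.
  let h : ℝ → E := fun t => g t + ((1 - t) • ((x : E) - g 0) + t • ((x : E) - g 1))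
  have hh : ContDiff ℝ 1 h := by fun_prop
  have h0 : h 0 = x := by simp [h]
  have h1 : h 1 = x := by simp [h]
  have hd0 : ‖(x : E) - g 0‖ < 1 / 4 := by
    have := hd 0
    rwa [γ.extend_zero, dist_comm, dist_eq_norm] at this
  have hd1 : ‖(x : E) - g 1‖ < 1 / 4 := by
    have := hd 1
    rwa [γ.extend_one, dist_comm, dist_eq_norm] at this
  have hclose : ∀ t : unitInterval, ‖h t - γ t‖ < 1 / 2 := by
    intro t
    have e1 : ‖g t - γ t‖ < 1 / 4 := by
      have := hd t
      rwa [Path.extend_apply _ t.2, dist_eq_norm] at this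
    have e2 : ‖(1 - (t : ℝ)) • ((x : E) - g 0) + (t : ℝ) • ((x : E) - g 1)‖ ≤ 1 / 4 := by
      refine (norm_add_le _ _).trans ?_
      rw [norm_smul, norm_smul, Real.norm_of_nonneg t.2.1,
        Real.norm_of_nonneg (by linarith [t.2.2])]
      nlinarith [t.2.1, t.2.2]
    calc ‖h t - γ t‖ = ‖(g t - γ t) + ((1 - (t : ℝ)) • ((x : E) - g 0) +
          (t : ℝ) • ((x : E) - g 1))‖ := by simp only [h]; congr 1; abel
      _ ≤ _ := norm_add_le _ _
      _ < 1 / 2 := by linarith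
  let k : unitInterval × unitInterval → E := fun p => (γ p.2 : E) + (p.1 : ℝ) • (h p.2 - γ p.2)
  have hk : Continuous k := by
    have := hh.continuous
    fun_prop
  have hk0 : ∀ p, k p ≠ 0 := by
    intro p hp
    have e1 : (γ p.2 : E) = -((p.1 : ℝ) • (h p.2 - γ p.2)) := eq_neg_of_add_eq_zero_left hp
    have e2 : ‖(γ p.2 : E)‖ = 1 := mem_sphere_zero_iff_norm.1 (γ p.2).2
    rw [e1, norm_neg, norm_smul, Real.norm_of_nonneg p.1.2.1] at e2
    nlinarith [hclose p.2, p.1.2.1, p.1.2.2, norm_nonneg (h p.2 - γ p.2)]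
  let K : unitInterval × unitInterval → Metric.sphere (0 : E) 1 := fun p =>
    ⟨‖k p‖⁻¹ • k p, by
      rw [mem_sphere_zero_iff_norm, norm_smul, norm_inv, norm_norm,
        inv_mul_cancel₀ (norm_ne_zero_iff.2 (hk0 p))]⟩
  have hK : Continuous K :=
    Continuous.subtype_mk ((hk.norm.inv₀ fun p => norm_ne_zero_iff.2 (hk0 p)).smul hk) _
  have hKof : ∀ p (y : Metric.sphere (0 : E) 1), k p = y → K p = y := by
    intro p y e
    refine Subtype.ext ?_
    change ‖k p‖⁻¹ • k p = y
    rw [e, mem_sphere_zero_iff_norm.1 y.2, inv_one, one_smul]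
  let γ' : Path x x :=
    { toFun := fun t => K (1, t)
      continuous_toFun := by fun_prop
      source' := hKof _ _ (by simp [k, h0])
      target' := hKof _ _ (by simp [k, h1]) }
  obtain ⟨w, hw⟩ : (range fun p : ℝ × ℝ => p.1 • h p.2)ᶜ.Nonempty := by
    refine (ContDiff.dense_compl_range_of_finrank_lt_finrank ?_ ?_).nonempty
    · exact contDiff_fst.smul (hh.comp contDiff_snd)
    · simpa using hE
  have hw0 : w ≠ 0 := fun e => hw ⟨(0, 0), by simp [e]⟩
  refine ⟨γ', ⟨‖w‖⁻¹ • w, by simp [norm_smul, hw0]⟩, ⟨?_⟩, ?_⟩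
  · exact
      { toFun := K
        continuous_toFun := hK
        map_zero_left := fun t => hKof _ _ (by simp [k])
        map_one_left := fun t => rfl
        prop' := by
          rintro s t (rfl | rfl)
          · exact hKof _ _ (by simp [k, h0])
          · exact hKof _ _ (by simp [k, h1]) }
  · intro t e
    have e' : ‖k (1, t)‖⁻¹ • k (1, t) = ‖w‖⁻¹ • w := congrArg Subtype.val e
    have e2 : k (1, t) = h t := by simp [k]
    rw [e2] at e'
    refine hw ⟨(‖w‖ * ‖h t‖⁻¹, t), ?_⟩
    change (‖w‖ * ‖h t‖⁻¹) • h t = w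
    rw [mul_smul, e', smul_smul, mul_inv_cancel₀ (norm_ne_zero_iff.2 hw0), one_smul]

theorem sphere_simplyConnected [FiniteDimensional ℝ E] (hE : 2 < Module.finrank ℝ E) :
    SimplyConnectedSpace (Metric.sphere (0 : E) 1) := by
  rw [simply_connected_iff_loops_nullhomotopic]
  refine ⟨?_, fun x γ => ?_⟩
  · rw [← isPathConnected_iff_pathConnectedSpace]
    refine isPathConnected_sphere ?_ _ zero_le_one
    rw [← Module.finrank_eq_rank]
    exact_mod_cast (by omega : 1 < Module.finrank ℝ E)
  · obtain ⟨γ', v, h, hv⟩ := sphere_exists_homotopic_notMem hE γ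
    exact h.trans (sphere_loop_homotopic_refl_of_notMem γ' hv)

end Sphere

instance : SimplyConnectedSpace S3 :=
  sphere_simplyConnected (by rw [Quaternion.finrank_eq_four]; norm_num)

instance : PathConnectedSpace SO3 := spin_surjective.pathConnectedSpace continuous_spin

theorem nonempty_fundamentalGroup_SO3 :
    Nonempty (FundamentalGroup SO3 1 ≃* Multiplicative (ZMod 2)) := by
  have e := isQuotientCoveringMap_spin.fundamentalGroupEquiv
    (x := 1) (⟨1, map_one spin⟩ : spin ⁻¹' {1})
  have hcard : Nat.card (spin.ker)ᵐᵒᵖ = 2 := by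
    rw [Nat.card_congr MulOpposite.opEquiv.symm]
    change Nat.card (spin.ker : Set S3) = 2
    rw [coe_ker_spin, Nat.card_coe_set_eq, Set.ncard_pair S3.neg_one_ne_one.symm]
  have : Fact (Nat.Prime 2) := ⟨Nat.prime_two⟩
  exact ⟨e.trans (mulEquivOfPrimeCardEq hcard (by simp))⟩

/-! ### Maps from the circle to the rotation group and their lifts to the three-sphere -/

theorem exists_spin_lift {A : Type*} [TopologicalSpace A] [SimplyConnectedSpace A]
    [LocallyPathConnectedSpace A] {f : A → SO3} (hf : Continuous f) :
    ∃ F : A → S3, Continuous F ∧ ∀ a, spin (F a) = f a := by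
  obtain ⟨a₀⟩ : Nonempty A := inferInstance
  obtain ⟨e₀, he⟩ := spin_surjective (f a₀)
  obtain ⟨F, ⟨-, hF⟩, -⟩ :=
    isCoveringMap_spin.existsUnique_continuousMap_lifts ⟨f, hf⟩ a₀ e₀ he
  exact ⟨F, F.continuous, fun a => congrFun hF a⟩

theorem spin_neg (q : S3) : spin (-q) = spin q := by
  have : spin (-1) = 1 := (spin_eq_one_iff _).2 (Or.inr rfl)
  rw [← neg_one_mul, map_mul, this, one_mul]

theorem spin_eq_iff {p q : S3} : spin p = spin q ↔ p = q ∨ p = -q := by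
  rw [← mul_inv_eq_one, ← map_inv, ← map_mul, spin_eq_one_iff, mul_inv_eq_one, mul_inv_eq_iff_eq_mul,
    neg_one_mul]

theorem spin_lift_eq {A : Type*} [TopologicalSpace A] [PreconnectedSpace A] {F G : A → S3}
    (hF : Continuous F) (hG : Continuous G) (h : ∀ a, spin (F a) = spin (G a)) {a₀ : A}
    (h₀ : F a₀ = G a₀) (a : A) : F a = G a :=
  congrFun (isCoveringMap_spin.eq_of_comp_eq hF hG (funext h) a₀ h₀) a

/-- Two lifts of the same map from a connected space differ by a constant sign. -/
theorem spin_lift_eq_or_neg {A : Type*} [TopologicalSpace A] [PreconnectedSpace A] [Nonempty A]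
    {F G : A → S3} (hF : Continuous F) (hG : Continuous G) (h : ∀ a, spin (F a) = spin (G a)) :
    (∀ a, F a = G a) ∨ ∀ a, F a = -G a := by
  obtain ⟨a₀⟩ : Nonempty A := inferInstance
  have hG' : Continuous fun a => -G a := by
    have : (fun a => -G a) = fun a => -1 * G a := by simp
    rw [this]
    exact continuous_const.mul hG
  rcases spin_eq_iff.1 (h a₀) with h0 | h0
  · exact Or.inl (spin_lift_eq hF hG h h0)
  · exact Or.inr (spin_lift_eq hF hG' (fun a => by rw [h, spin_neg]) h0)

theorem isQuotientMap_circleExp : Topology.IsQuotientMap Circle.exp :=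
  isLocalHomeomorph_circleExp.isOpenMap.isQuotientMap Circle.exp.continuous Circle.exp_surjective

theorem exists_circle_of_periodic {X : Type*} [TopologicalSpace X] {f : ℝ → X}
    (hf : Continuous f) (hp : Function.Periodic f (2 * Real.pi)) :
    ∃ φ : C(Circle, X), ∀ t, φ (Circle.exp t) = f t := by
  have hker : ∀ a b, Circle.exp a = Circle.exp b → f a = f b := by
    intro a b h
    obtain ⟨m, rfl⟩ := Circle.exp_eq_exp.1 h
    exact hp.int_mul m b
  refine ⟨isQuotientMap_circleExp.lift ⟨f, hf⟩ hker, fun t => ?_⟩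
  exact congrFun (congrArg DFunLike.coe (isQuotientMap_circleExp.lift_comp ⟨f, hf⟩ hker)) t

/-- A map from the circle to the rotation group is *even* if it lifts to the three-sphere. -/
def EvenLoop (φ : Circle → SO3) : Prop :=
  ∃ ψ : Circle → S3, Continuous ψ ∧ ∀ u, spin (ψ u) = φ u

theorem EvenLoop.of_periodic {φ : Circle → SO3} {L : ℝ → S3} (hL : Continuous L)
    (hs : ∀ t, spin (L t) = φ (Circle.exp t)) (hp : Function.Periodic L (2 * Real.pi)) :
    EvenLoop φ := by
  obtain ⟨ψ, hψ⟩ := exists_circle_of_periodic hL hp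
  refine ⟨ψ, ψ.continuous, fun u => ?_⟩
  obtain ⟨t, rfl⟩ := Circle.exp_surjective u
  rw [hψ, hs]

theorem exists_periodic_or_antiperiodic_lift {φ : Circle → SO3} (hφ : Continuous φ) :
    ∃ L : ℝ → S3, Continuous L ∧ (∀ t, spin (L t) = φ (Circle.exp t)) ∧
      (Function.Periodic L (2 * Real.pi) ∨ Function.Antiperiodic L (2 * Real.pi)) := by
  obtain ⟨L, hL, hs⟩ := exists_spin_lift (hφ.comp Circle.exp.continuous)
  refine ⟨L, hL, hs, spin_lift_eq_or_neg (by fun_prop) hL fun t => ?_⟩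
  rw [hs, hs, Function.comp_apply, Function.comp_apply, Circle.exp_add, Circle.exp_two_pi, mul_one]

theorem EvenLoop.mul {φ ψ : Circle → SO3} (h : EvenLoop φ) (h' : EvenLoop ψ) :
    EvenLoop fun u => φ u * ψ u := by
  obtain ⟨a, ha, ha'⟩ := h
  obtain ⟨b, hb, hb'⟩ := h'
  exact ⟨fun u => a u * b u, ha.mul hb, fun u => by rw [map_mul, ha', hb']⟩

theorem EvenLoop.inv {φ : Circle → SO3} (h : EvenLoop φ) : EvenLoop fun u => (φ u)⁻¹ := by
  obtain ⟨a, ha, ha'⟩ := h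
  exact ⟨fun u => (a u)⁻¹, ha.inv, fun u => by rw [map_inv, ha']⟩

/-- The product of two maps that are not even is even, as the signs of their lifts cancel. -/
theorem EvenLoop.mul_of_not {φ ψ : Circle → SO3} (hφ : Continuous φ) (hψ : Continuous ψ)
    (h : ¬ EvenLoop φ) (h' : ¬ EvenLoop ψ) : EvenLoop fun u => φ u * ψ u := by
  obtain ⟨L, hL, hs, hp⟩ := exists_periodic_or_antiperiodic_lift hφ
  obtain ⟨M, hM, ht, hq⟩ := exists_periodic_or_antiperiodic_lift hψ
  replace hp := hp.resolve_left fun hp => h (.of_periodic hL hs hp)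
  replace hq := hq.resolve_left fun hq => h' (.of_periodic hM ht hq)
  refine .of_periodic (L := fun t => L t * M t) (hL.mul hM) (fun t => by rw [map_mul, hs, ht])
    fun t => ?_
  change L (t + 2 * Real.pi) * M (t + 2 * Real.pi) = _
  rw [hp, hq, neg_mul_neg]

theorem EvenLoop.of_continuous_extension {φ : Circle → SO3} {E : ℂ → SO3} (hE : Continuous E)
    (h : ∀ u : Circle, E u = φ u) : EvenLoop φ := by
  obtain ⟨F, hF, hs⟩ := exists_spin_lift hE
  exact ⟨fun u => F u, hF.comp continuous_subtype_val, fun u => by rw [hs, h]⟩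

/-- The nearest-point retraction of the plane to the closed unit disc. -/
noncomputable def discRetract (z : ℂ) : UnitDisc :=
  ⟨((max 1 ‖z‖)⁻¹ : ℝ) • z, by
    have h : 0 < max 1 ‖z‖ := lt_max_of_lt_left one_pos
    rw [mem_closedBall_zero_iff, norm_smul, Real.norm_of_nonneg (inv_nonneg.2 h.le), inv_mul_le_one₀ h]
    exact le_max_right _ _⟩

theorem continuous_discRetract : Continuous discRetract := by
  refine Continuous.subtype_mk (Continuous.smul (Continuous.inv₀ (continuous_const.max continuous_norm) fun z => ?_)
    continuous_id) _
  exact (lt_max_of_lt_left one_pos).ne'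

theorem discRetract_coe (z : UnitDisc) : discRetract z = z := by
  refine Subtype.ext ?_
  change ((max 1 ‖z.1‖)⁻¹ : ℝ) • z.1 = z.1
  rw [max_eq_left (mem_closedBall_zero_iff.1 z.2), inv_one, one_smul]

/-- Polar coordinates on the closed unit disc. -/
noncomputable def polar (p : unitInterval × unitInterval) : UnitDisc :=
  ⟨(p.1 : ℝ) • (Circle.exp (2 * Real.pi * p.2) : ℂ), by
    rw [mem_closedBall_zero_iff, norm_smul, Circle.norm_coe, mul_one,
      Real.norm_of_nonneg p.1.2.1]
    exact p.1.2.2⟩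

theorem continuous_polar : Continuous polar :=
  Continuous.subtype_mk (by fun_prop) _

theorem exists_circleExp_two_pi_mul (u : Circle) :
    ∃ t ∈ Ico (0 : ℝ) 1, u = Circle.exp (2 * Real.pi * t) := by
  obtain ⟨s, rfl⟩ := Circle.exp_surjective u
  refine ⟨Int.fract (s / (2 * Real.pi)), ⟨Int.fract_nonneg _, Int.fract_lt_one _⟩, ?_⟩
  rw [Circle.exp_eq_exp]
  refine ⟨⌊s / (2 * Real.pi)⌋, ?_⟩
  have := Real.pi_pos
  have h := Int.fract_add_floor (s / (2 * Real.pi))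
  field_simp at h ⊢
  linarith

theorem polar_surjective : Function.Surjective polar := by
  intro z
  obtain ⟨t, ht, h⟩ := exists_circleExp_two_pi_mul (Circle.exp z.1.arg)
  refine ⟨(⟨‖z.1‖, norm_nonneg _, mem_closedBall_zero_iff.1 z.2⟩, ⟨t, ht.1, ht.2.le⟩), ?_⟩
  refine Subtype.ext ?_
  change ‖z.1‖ • (Circle.exp (2 * Real.pi * t) : ℂ) = z.1
  rw [← h, Circle.coe_exp, Complex.real_smul, Complex.norm_mul_exp_arg_mul_I]

theorem isQuotientMap_polar : Topology.IsQuotientMap polar :=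
  continuous_polar.isClosedMap.isQuotientMap continuous_polar polar_surjective

theorem polar_eq_polar {p q : unitInterval × unitInterval} (h : polar p = polar q) :
    p.1 = q.1 ∧ (p.1 = 0 ∨ Circle.exp (2 * Real.pi * p.2) = Circle.exp (2 * Real.pi * q.2)) := by
  have h1 : (p.1 : ℝ) • (Circle.exp (2 * Real.pi * p.2) : ℂ) =
    (q.1 : ℝ) • (Circle.exp (2 * Real.pi * q.2) : ℂ) := congrArg Subtype.val h
  have h2 := congrArg norm h1
  rw [norm_smul, norm_smul, Circle.norm_coe, Circle.norm_coe, mul_one, mul_one,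
    Real.norm_of_nonneg p.1.2.1, Real.norm_of_nonneg q.1.2.1] at h2
  refine ⟨Subtype.ext h2, ?_⟩
  by_cases h0 : (p.1 : ℝ) = 0
  · exact Or.inl (Subtype.ext h0)
  · right
    rw [← h2] at h1
    exact Subtype.ext (smul_right_injective ℂ h0 h1)

theorem eq_or_endpoints_of_circleExp_eq {s t : unitInterval}
    (h : Circle.exp (2 * Real.pi * s) = Circle.exp (2 * Real.pi * t)) :
    s = t ∨ (s = 0 ∧ t = 1) ∨ (s = 1 ∧ t = 0) := by
  obtain ⟨m, hm⟩ := Circle.exp_eq_exp.1 h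
  have hs : (s : ℝ) = t + m := by
    have := Real.pi_pos
    have h2 : 2 * Real.pi * s = 2 * Real.pi * (t + m) := by rw [hm]; ring
    exact mul_left_cancel₀ (by positivity) h2
  have h1 : m < 2 := by
    have : (m : ℝ) < 2 := by linarith [s.2.2, t.2.1]
    exact_mod_cast this
  have h2 : -2 < m := by
    have : (-2 : ℝ) < m := by linarith [s.2.1, t.2.2]
    exact_mod_cast this
  obtain rfl | rfl | rfl : m = 0 ∨ m = 1 ∨ m = -1 := by omega
  · exact Or.inl (Subtype.ext (by simpa using hs))
  · right; right
    push_cast at hs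
    exact ⟨Subtype.ext (by rw [Set.Icc.coe_one]; linarith [s.2.2, t.2.1]), Subtype.ext (by rw [Set.Icc.coe_zero]; linarith [s.2.2, t.2.1])⟩
  · right; left
    push_cast at hs
    exact ⟨Subtype.ext (by rw [Set.Icc.coe_zero]; linarith [s.2.1, t.2.2]), Subtype.ext (by rw [Set.Icc.coe_one]; linarith [s.2.1, t.2.2])⟩

/-- A map from the circle to a simply connected space extends to the plane. -/
theorem exists_extension_of_simplyConnected {X : Type*} [TopologicalSpace X]
    [SimplyConnectedSpace X] {g : Circle → X} (hg : Continuous g) :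
    ∃ G : ℂ → X, Continuous G ∧ ∀ u : Circle, G u = g u := by
  let γ : Path (g 1) (g 1) :=
    { toFun := fun t => g (Circle.exp (2 * Real.pi * t))
      continuous_toFun := by fun_prop
      source' := by simp
      target' := by simp }
  obtain ⟨H⟩ := SimplyConnectedSpace.paths_homotopic γ (Path.refl _)
  let P : C(unitInterval × unitInterval, UnitDisc) := ⟨polar, continuous_polar⟩
  have hP : Topology.IsQuotientMap P := isQuotientMap_polar
  let f : C(unitInterval × unitInterval, X) :=
    ⟨fun p => H (unitInterval.symm p.1, p.2), by fun_prop⟩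
  have hker : ∀ p q, polar p = polar q → f p = f q := by
    rintro ⟨r, s⟩ ⟨r', t⟩ h
    obtain ⟨h1, h2⟩ := polar_eq_polar h
    simp only at h1 h2
    subst h1
    change H _ = H _
    rcases h2 with rfl | h2
    · simp
    · rcases eq_or_endpoints_of_circleExp_eq h2 with rfl | ⟨rfl, rfl⟩ | ⟨rfl, rfl⟩ <;> simp
  let G := hP.lift f fun p q h => hker p q h
  have hG : ∀ p, G (polar p) = f p :=
    congrFun (congrArg DFunLike.coe (hP.lift_comp f fun p q h => hker p q h))
  refine ⟨fun z => G (discRetract z), G.continuous.comp continuous_discRetract, fun u => ?_⟩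
  obtain ⟨t, ht, rfl⟩ := exists_circleExp_two_pi_mul u
  have hp : discRetract (Circle.exp (2 * Real.pi * t)) = polar (1, ⟨t, ht.1, ht.2.le⟩) := by
    rw [← discRetract_coe (polar _)]
    congr 1
    simp [polar]
  change G _ = _
  rw [hp, hG]
  change H _ = _
  simp [γ]

theorem EvenLoop.exists_extension {φ : Circle → SO3} (h : EvenLoop φ) :
    ∃ E : ℂ → SO3, Continuous E ∧ ∀ u : Circle, E u = φ u := by
  obtain ⟨ψ, hψ, hs⟩ := h
  obtain ⟨G, hG, hu⟩ := exists_extension_of_simplyConnected hψ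
  exact ⟨fun z => spin (G z), continuous_spin.comp hG, fun u => (congrArg spin (hu u)).trans (hs u)⟩

theorem loopClass_eq_one_iff (φ : C(Circle, SO3)) : loopClass φ = 1 ↔ EvenLoop φ := by
  constructor
  · intro h
    have hh : (circleLoop φ).Homotopic (Path.refl _) :=
      Path.Homotopic.Quotient.eq.1 (h.trans rfl)
    obtain ⟨L, hL, hs, hp | hp⟩ := exists_periodic_or_antiperiodic_lift φ.continuous
    · exact .of_periodic hL hs hp
    exfalso
    have hs0 : φ 1 = spin (L 0) := by rw [hs]; simp
    have e := isCoveringMap_spin.liftPath_apply_one_eq_of_homotopicRel hh (L 0)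
      (by simpa using hs0) (by simpa using hs0)
    have e1 : (fun t : unitInterval => L (2 * Real.pi * t)) = _ :=
      (isCoveringMap_spin.eq_liftPath_iff (γ := (circleLoop φ).toContinuousMap) (e := L 0)
        (γ_0 := by simpa using hs0)).2
        ⟨by fun_prop, funext fun t => hs _, by simp⟩
    have e2 : (fun _ : unitInterval => L 0) = _ :=
      (isCoveringMap_spin.eq_liftPath_iff (γ := (Path.refl (φ 1)).toContinuousMap) (e := L 0)
        (γ_0 := by simpa using hs0)).2
        ⟨by fun_prop, funext fun t => hs0.symm, rfl⟩
    have e3 : L (2 * Real.pi * (1 : unitInterval)) = L 0 :=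
      (congrFun e1 1).trans (e.trans (congrFun e2 1).symm)
    have e4 := hp 0
    rw [zero_add] at e4
    rw [Set.Icc.coe_one, mul_one, e4] at e3
    refine S3.neg_one_ne_one (mul_right_cancel (b := L 0) ?_)
    rw [neg_one_mul, one_mul, e3]
  · rintro ⟨ψ, hψ, hs⟩
    let γ : Path (ψ 1) (ψ 1) :=
      { toFun := fun t => ψ (Circle.exp (2 * Real.pi * t))
        continuous_toFun := by fun_prop
        source' := by simp
        target' := by simp }
    obtain ⟨F⟩ := (SimplyConnectedSpace.paths_homotopic γ (Path.refl _)).map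
      ⟨spin, continuous_spin⟩
    refine Path.Homotopic.Quotient.eq.2 ⟨(F.pathCast (hs 1).symm (hs 1).symm).cast
      (Path.ext (funext fun t => hs _)) (Path.ext (funext fun _ => hs 1))⟩

/-- The full turn about an axis is not even. -/
theorem exists_loopClass_ne_one : ∃ φ : C(Circle, SO3), loopClass φ ≠ 1 := by
  obtain ⟨i, h0, h1, h2, h3⟩ : ∃ i : Quaternion ℝ, i.re = 0 ∧ i.imI = 1 ∧ i.imJ = 0 ∧ i.imK = 0 :=
    ⟨⟨0, 1, 0, 0⟩, rfl, rfl, rfl, rfl⟩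
  let L : ℝ → S3 := fun t => ⟨Real.cos (t / 2) • (1 : Quaternion ℝ) + Real.sin (t / 2) • i,
    (mem_sphere_iff_sum_sq _).2 (by
      change (Real.cos (t / 2) * 1 + Real.sin (t / 2) * i.re) ^ 2 +
        (Real.cos (t / 2) * 0 + Real.sin (t / 2) * i.imI) ^ 2 +
        (Real.cos (t / 2) * 0 + Real.sin (t / 2) * i.imJ) ^ 2 +
        (Real.cos (t / 2) * 0 + Real.sin (t / 2) * i.imK) ^ 2 = 1
      simp [h0, h1, h2, h3])⟩
  have hL : Continuous L := Continuous.subtype_mk (by fun_prop) _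
  have hp : ∀ t, L (t + 2 * Real.pi) = -L t := by
    intro t
    have : (t + 2 * Real.pi) / 2 = t / 2 + Real.pi := by ring
    refine Subtype.ext ?_
    change Real.cos ((t + 2 * Real.pi) / 2) • (1 : Quaternion ℝ) + Real.sin ((t + 2 * Real.pi) / 2) • i =
      -(Real.cos (t / 2) • (1 : Quaternion ℝ) + Real.sin (t / 2) • i)
    rw [this, Real.cos_add_pi, Real.sin_add_pi]
    module
  obtain ⟨φ, hφ⟩ := exists_circle_of_periodic (continuous_spin.comp hL)
    (fun t => by simp only [Function.comp_apply]; rw [hp, spin_neg])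
  refine ⟨φ, fun h => ?_⟩
  obtain ⟨ψ, hψ, hs⟩ := (loopClass_eq_one_iff φ).1 h
  have hneg : ∀ q : S3, q ≠ -q := by
    intro q hq
    refine S3.neg_one_ne_one (mul_right_cancel (b := q) ?_)
    rw [neg_one_mul, one_mul, ← hq]
  have hψL := spin_lift_eq_or_neg (F := fun t => ψ (Circle.exp t)) (G := L) (by fun_prop) hL
    fun t => by rw [hs, hφ]; rfl
  have h2 : ψ (Circle.exp (0 + 2 * Real.pi)) = ψ (Circle.exp 0) := by simp
  rcases hψL with h | h
  · rw [h, h, hp] at h2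
    exact hneg _ h2.symm
  · rw [h, h, hp, neg_neg] at h2
    exact hneg _ h2

/-! ### An equivariant frame from three distinct points of the sphere -/

section Frame

open Matrix

/-- The Gram-Schmidt frame of two vectors `u`, `v`: its columns are the normalizations of `u`,
`(u × v) × u` and `u × v`. -/
noncomputable def gramMatrix (u v : Fin 3 → ℝ) : Matrix (Fin 3) (Fin 3) ℝ :=
  (Matrix.of ![(√(u ⬝ᵥ u))⁻¹ • u,
    ((√(u ⬝ᵥ u))⁻¹ * (√((u ⨯₃ v) ⬝ᵥ (u ⨯₃ v)))⁻¹) • ((u ⨯₃ v) ⨯₃ u),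
    (√((u ⨯₃ v) ⬝ᵥ (u ⨯₃ v)))⁻¹ • (u ⨯₃ v)])ᵀ

theorem dotProduct_self_pos {u : Fin 3 → ℝ} (hu : u ≠ 0) : 0 < u ⬝ᵥ u := by
  refine lt_of_le_of_ne ?_ (Ne.symm fun h => hu (dotProduct_self_eq_zero.1 h))
  simpa using dotProduct_star_self_nonneg u

theorem gramMatrix_mem {u v : Fin 3 → ℝ} (h : u ⨯₃ v ≠ 0) :
    gramMatrix u v ∈ Matrix.specialOrthogonalGroup (Fin 3) ℝ := by
  have hu : u ≠ 0 := by
    rintro rfl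
    simp at h
  have hu' := dotProduct_self_pos hu
  have hn' := dotProduct_self_pos h
  have hun : u ⬝ᵥ (u ⨯₃ v) = 0 := dot_self_cross u v
  rw [gramMatrix]
  set n := u ⨯₃ v
  obtain ⟨a, ha⟩ : ∃ a, a = (√(u ⬝ᵥ u))⁻¹ := ⟨_, rfl⟩
  obtain ⟨c, hc⟩ : ∃ c, c = (√(n ⬝ᵥ n))⁻¹ := ⟨_, rfl⟩
  have ha2 : a ^ 2 * (u ⬝ᵥ u) = 1 := by
    rw [ha, inv_pow, Real.sq_sqrt hu'.le, inv_mul_cancel₀ hu'.ne']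
  have hc2 : c ^ 2 * (n ⬝ᵥ n) = 1 := by
    rw [hc, inv_pow, Real.sq_sqrt hn'.le, inv_mul_cancel₀ hn'.ne']
  rw [← ha, ← hc]
  clear_value n
  simp only [dotProduct, Fin.sum_univ_three] at ha2 hc2 hun
  have hac := congrArg₂ (· * ·) ha2 hc2
  simp only [mul_one] at hac
  rw [Matrix.mem_specialOrthogonalGroup_iff, Matrix.mem_orthogonalGroup_iff']
  constructor
  · ext i j
    fin_cases i <;> fin_cases j <;>
      simp [Matrix.mul_apply, Fin.sum_univ_three, cross_apply]
    · linear_combination ha2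
    · ring
    · linear_combination a * c * hun
    · ring
    · linear_combination hac - a ^ 2 * c ^ 2 * (u 0 * n 0 + u 1 * n 1 + u 2 * n 2) * hun
    · ring
    · linear_combination a * c * hun
    · ring
    · linear_combination hc2
  · rw [Matrix.det_fin_three]
    simp [cross_apply]
    linear_combination hac - a ^ 2 * c ^ 2 * (u 0 * n 0 + u 1 * n 1 + u 2 * n 2) * hun

theorem SO3.adjugate_eq (A : SO3) : A.1.adjugate = A.1ᵀ := by
  have hd : A.1.det = 1 := (Matrix.mem_specialOrthogonalGroup_iff.1 A.2).2
  have h : A.1.adjugate * A.1 = 1 := by rw [Matrix.adjugate_mul, hd, one_smul]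
  have h2 : A.1 * A.1ᵀ = 1 :=
    (Matrix.mem_orthogonalGroup_iff (Fin 3) ℝ).1 (Matrix.mem_specialOrthogonalGroup_iff.1 A.2).1
  exact left_inv_eq_right_inv h h2

/-- Rotations preserve the cross product. -/
theorem SO3.mulVec_cross (A : SO3) (u v : Fin 3 → ℝ) :
    (A.1 *ᵥ u) ⨯₃ (A.1 *ᵥ v) = A.1 *ᵥ (u ⨯₃ v) := by
  have e : ∀ i j, A.1 i j = (A.1.adjugate) j i := fun i j => by
    rw [SO3.adjugate_eq, Matrix.transpose_apply]
  have h : A.1 *ᵥ (u ⨯₃ v) = (A.1.adjugateᵀ) *ᵥ (u ⨯₃ v) := by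
    rw [SO3.adjugate_eq, Matrix.transpose_transpose]
  rw [h, Matrix.adjugate_fin_three]
  ext i
  fin_cases i <;>
    simp [cross_apply, Matrix.mulVec, dotProduct, Fin.sum_univ_three] <;> ring

theorem SO3.mulVec_dotProduct (A : SO3) (u v : Fin 3 → ℝ) :
    (A.1 *ᵥ u) ⬝ᵥ (A.1 *ᵥ v) = u ⬝ᵥ v := by
  rw [Matrix.dotProduct_mulVec, Matrix.vecMul_mulVec, SO3.transpose_mul_self, Matrix.vecMul_one]

theorem gramMatrix_mulVec (A : SO3) (u v : Fin 3 → ℝ) :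
    gramMatrix (A.1 *ᵥ u) (A.1 *ᵥ v) = A.1 * gramMatrix u v := by
  rw [gramMatrix, SO3.mulVec_cross, SO3.mulVec_cross, SO3.mulVec_dotProduct,
    SO3.mulVec_dotProduct, gramMatrix]
  simp only [← Matrix.mulVec_smul]
  ext i j
  fin_cases j <;> rfl

theorem continuousOn_gramMatrix {X : Type*} [TopologicalSpace X] {u v : X → Fin 3 → ℝ}
    {s : Set X} (hu : ContinuousOn u s) (hv : ContinuousOn v s)
    (h : ∀ x ∈ s, u x ⨯₃ v x ≠ 0) : ContinuousOn (fun x => gramMatrix (u x) (v x)) s := by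
  have hu0 : ∀ x ∈ s, √(u x ⬝ᵥ u x) ≠ 0 := fun x hx => by
    refine (Real.sqrt_pos.2 (dotProduct_self_pos fun h0 => h x hx ?_)).ne'
    simp [h0]
  have hn0 : ∀ x ∈ s, √((u x ⨯₃ v x) ⬝ᵥ (u x ⨯₃ v x)) ≠ 0 := fun x hx =>
    (Real.sqrt_pos.2 (dotProduct_self_pos (h x hx))).ne'
  have hcross : ∀ f g : X → Fin 3 → ℝ, ContinuousOn f s → ContinuousOn g s →
      ContinuousOn (fun x => f x ⨯₃ g x) s := by
    intro f g hf hg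
    simp only [cross_apply]
    refine continuousOn_pi.2 fun i => ?_
    have hf' := continuousOn_pi.1 hf
    have hg' := continuousOn_pi.1 hg
    have h0 := hf' 0
    have h1 := hf' 1
    have h2 := hf' 2
    have k0 := hg' 0
    have k1 := hg' 1
    have k2 := hg' 2
    fin_cases i <;> simp <;> fun_prop
  have hdot : ∀ f : X → Fin 3 → ℝ, ContinuousOn f s → ContinuousOn (fun x => f x ⬝ᵥ f x) s := by
    intro f hf
    simp only [dotProduct]
    have hf' := continuousOn_pi.1 hf
    fun_prop
  have ha := ((hdot u hu).sqrt).inv₀ hu0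
  have hc := ((hdot _ (hcross u v hu hv)).sqrt).inv₀ hn0
  have hmat : ContinuousOn (fun x => ![(√(u x ⬝ᵥ u x))⁻¹ • u x,
      ((√(u x ⬝ᵥ u x))⁻¹ * (√((u x ⨯₃ v x) ⬝ᵥ (u x ⨯₃ v x)))⁻¹) • ((u x ⨯₃ v x) ⨯₃ u x),
      (√((u x ⨯₃ v x) ⬝ᵥ (u x ⨯₃ v x)))⁻¹ • (u x ⨯₃ v x)]) s := by
    refine continuousOn_pi.2 fun i => ?_
    fin_cases i
    · exact ha.smul hu
    · exact (ha.mul hc).smul (hcross _ _ (hcross u v hu hv) hu)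
    · exact hc.smul (hcross u v hu hv)
  refine continuousOn_pi.2 fun i => continuousOn_pi.2 fun j => ?_
  exact continuousOn_pi.1 (continuousOn_pi.1 hmat j) i

/-- Three distinct points of a sphere are not on a line. -/
theorem cross_sub_ne_zero {p q s : S2} (hpq : p ≠ q) (hps : p ≠ s) (hqs : q ≠ s) :
    (q.1.ofLp - p.1.ofLp) ⨯₃ (s.1.ofLp - p.1.ofLp) ≠ 0 := by
  have hnorm : ∀ y : S2, y.1.ofLp ⬝ᵥ y.1.ofLp = 1 := by
    intro y
    have h1 := EuclideanSpace.real_norm_sq_eq y.1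
    rw [mem_sphere_zero_iff_norm.1 y.2, one_pow] at h1
    simp only [dotProduct, ← sq]
    exact h1.symm
  have hinj : ∀ y z : S2, y.1.ofLp = z.1.ofLp → y = z := fun y z h =>
    Subtype.ext (WithLp.ofLp_injective 2 h)
  intro h
  obtain ⟨u, hu⟩ : ∃ u, u = q.1.ofLp - p.1.ofLp := ⟨_, rfl⟩
  obtain ⟨v, hv⟩ : ∃ v, v = s.1.ofLp - p.1.ofLp := ⟨_, rfl⟩
  rw [← hu, ← hv] at h
  have hu0 : u ≠ 0 := fun h0 => hpq (hinj _ _ (sub_eq_zero.1 (hu.symm.trans h0)).symm)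
  have huu := dotProduct_self_pos hu0
  have e1 : (u ⬝ᵥ v) • u = (u ⬝ᵥ u) • v := by
    have := cross_cross_eq_smul_sub_smul' u u v
    rw [h] at this
    simp at this
    exact sub_eq_zero.1 this.symm
  set t := (u ⬝ᵥ v) / (u ⬝ᵥ u) with ht
  have e2 : v = t • u := by
    rw [ht, div_eq_inv_mul, mul_smul, e1, smul_smul, inv_mul_cancel₀ huu.ne', one_smul]
  have hq : q.1.ofLp = p.1.ofLp + u := by rw [hu]; abel
  have hs : s.1.ofLp = p.1.ofLp + t • u := by rw [← e2, hv]; abel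
  have nq := hnorm q
  have ns := hnorm s
  have np := hnorm p
  rw [hq, add_dotProduct, dotProduct_add, dotProduct_add, dotProduct_comm u p.1.ofLp, np] at nq
  rw [hs, add_dotProduct, dotProduct_add, dotProduct_add, smul_dotProduct, dotProduct_smul,
    smul_dotProduct, dotProduct_smul, dotProduct_comm u p.1.ofLp, np] at ns
  simp only [smul_eq_mul] at ns
  have h01 : t * (t - 1) * (u ⬝ᵥ u) = 0 := by linear_combination ns - t * nq
  rcases mul_eq_zero.1 ((mul_eq_zero.1 h01).resolve_right huu.ne') with h0 | h1
  · refine hps (hinj _ _ ?_)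
    rw [hs, h0, zero_smul, add_zero]
  · refine hqs (hinj _ _ ?_)
    rw [hs, sub_eq_zero.1 h1, one_smul, hq]

open Classical in
/-- The frame of a triple of points of the sphere, with the junk value `1` where the three points
are not distinct. -/
noncomputable def tripleFrame (y : Fin 3 → S2) : SO3 :=
  if h : gramMatrix ((y 1).1.ofLp - (y 0).1.ofLp) ((y 2).1.ofLp - (y 0).1.ofLp) ∈
      Matrix.specialOrthogonalGroup (Fin 3) ℝ then ⟨_, h⟩ else 1

theorem tripleFrame_coe {y : Fin 3 → S2} (hy : Function.Injective y) : (tripleFrame y).1 =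
    gramMatrix ((y 1).1.ofLp - (y 0).1.ofLp) ((y 2).1.ofLp - (y 0).1.ofLp) := by
  rw [tripleFrame, dif_pos]
  exact gramMatrix_mem (cross_sub_ne_zero (hy.ne (by decide)) (hy.ne (by decide))
    (hy.ne (by decide)))

theorem rotate_injective (A : SO3) : Function.Injective (rotate A) :=
  Function.LeftInverse.injective (rotate_inv_rotate A)

theorem tripleFrame_rotate (A : SO3) {y : Fin 3 → S2} (hy : Function.Injective y) :
    tripleFrame (fun i => rotate A (y i)) = A * tripleFrame y := by
  refine Subtype.ext ?_
  change _ = A.1 * (tripleFrame y).1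
  rw [tripleFrame_coe (y := fun i => rotate A (y i)) ((rotate_injective A).comp hy),
    tripleFrame_coe hy, ← gramMatrix_mulVec,
    Matrix.mulVec_sub, Matrix.mulVec_sub]
  rfl

theorem continuousOn_tripleFrame {X : Type*} [TopologicalSpace X] {s : Set X}
    {y : Fin 3 → X → S2} (hy : ∀ i, ContinuousOn (y i) s)
    (hi : ∀ x ∈ s, Function.Injective fun i => y i x) :
    ContinuousOn (fun x => tripleFrame fun i => y i x) s := by
  refine Topology.IsInducing.subtypeVal.continuousOn_iff.2 ?_
  have hc : ∀ i, ContinuousOn (fun x => (y i x).1.ofLp) s := fun i =>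
    (PiLp.continuous_ofLp 2 _).comp_continuousOn (continuous_subtype_val.comp_continuousOn (hy i))
  refine ContinuousOn.congr (continuousOn_gramMatrix ((hc 1).sub (hc 0)) ((hc 2).sub (hc 0)) ?_)
    fun x hx => tripleFrame_coe (hi x hx)
  exact fun x hx => cross_sub_ne_zero ((hi x hx).ne (by decide)) ((hi x hx).ne (by decide))
    ((hi x hx).ne (by decide))

end Frame

/-! ### The clutched bundle of a loop that is not even -/

open Surface Clutching

theorem circlePt_add_period {g : ℕ} (hg : 1 ≤ g) (t : ℝ) :
    circlePt g (t + 4 * g) = circlePt g t := by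
  have hg0 : (g : ℝ) ≠ 0 := by positivity
  rw [circlePt, circlePt, Circle.exp_eq_exp]
  exact ⟨1, by field_simp; push_cast; ring⟩

theorem continuous_circlePt (g : ℕ) : Continuous (circlePt g) := by
  unfold circlePt
  fun_prop

theorem circlePt_mul_div {g : ℕ} (hg : 1 ≤ g) (t : ℝ) :
    circlePt g (t * (4 * g) / (2 * Real.pi)) = Circle.exp t := by
  have hg0 : (g : ℝ) ≠ 0 := by positivity
  have := Real.pi_ne_zero
  rw [circlePt]
  congr 1
  field_simp

theorem mk_circlePt_eq {g : ℕ} {z w : UnitDisc} (j : Fin g) (c : Fin 2) {s : ℝ}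
    (hs : s ∈ Icc (0 : ℝ) 1) (hz : z.1 = circlePt g (4 * (j : ℕ) + (c : ℕ) + s))
    (hw : w.1 = circlePt g (4 * (j : ℕ) + (c : ℕ) + 3 - s)) : mk g z = mk g w :=
  Quot.sound ⟨j, c, s, hs, hz, hw⟩

theorem circlePt_mem (g : ℕ) (r : ℝ) (hr : r ∈ Icc (0 : ℝ) 1) (t : ℝ) :
    (r • (circlePt g t : ℂ)) ∈ Metric.closedBall (0 : ℂ) 1 := by
  rw [mem_closedBall_zero_iff, norm_smul, Circle.norm_coe, mul_one, Real.norm_of_nonneg hr.1]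
  exact hr.2

/-- A lift to the three-sphere of a map on the boundary of the polygon that is compatible with the
side identifications closes up: each of the two pairs of sides of a handle contributes the same
sign twice. -/
theorem lift_boundary_closed {g : ℕ} {F : ℝ → S3} (hF : Continuous F)
    (h : ∀ (j : Fin g) (c : Fin 2), ∀ s ∈ Icc (0 : ℝ) 1,
      spin (F (4 * (j : ℕ) + (c : ℕ) + s)) = spin (F (4 * (j : ℕ) + (c : ℕ) + 3 - s))) :
    F (4 * g) = F 0 := by
  have key : ∀ (j : Fin g) (c : Fin 2),
      (F (4 * (j : ℕ) + (c : ℕ)) = F (4 * (j : ℕ) + (c : ℕ) + 3) ∧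
        F (4 * (j : ℕ) + (c : ℕ) + 1) = F (4 * (j : ℕ) + (c : ℕ) + 2)) ∨
      (F (4 * (j : ℕ) + (c : ℕ)) = -F (4 * (j : ℕ) + (c : ℕ) + 3) ∧
        F (4 * (j : ℕ) + (c : ℕ) + 1) = -F (4 * (j : ℕ) + (c : ℕ) + 2)) := by
    intro j c
    have := spin_lift_eq_or_neg (A := unitInterval)
      (F := fun s => F (4 * (j : ℕ) + (c : ℕ) + s)) (G := fun s => F (4 * (j : ℕ) + (c : ℕ) + 3 - s))
      (by fun_prop) (by fun_prop) fun s => h j c s s.2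
    have e : (4 * (j : ℕ) + (c : ℕ) + 3 - 1 : ℝ) = 4 * (j : ℕ) + (c : ℕ) + 2 := by ring
    refine this.imp (fun h => ⟨?_, ?_⟩) fun h => ⟨?_, ?_⟩
    · simpa using h 0
    · simpa [e] using h 1
    · simpa using h 0
    · simpa [e] using h 1
  have step : ∀ n : ℕ, n ≤ g → F (4 * n) = F 0 := by
    intro n
    induction n with
    | zero => simp
    | succ n ih =>
      intro hn
      have h0 := key ⟨n, hn⟩ 0
      have h1 := key ⟨n, hn⟩ 1
      have e1 : (4 * (n : ℝ) + 1 + 1) = 4 * n + 2 := by ring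
      have e2 : (4 * (n : ℝ) + 1 + 2) = 4 * n + 3 := by ring
      have e3 : (4 * ((n + 1 : ℕ) : ℝ)) = 4 * n + 1 + 3 := by push_cast; ring
      simp only [Fin.coe_ofNat_eq_mod, Nat.zero_mod, Nat.cast_zero, add_zero, Nat.one_mod,
        Nat.cast_one, e1, e2] at h0 h1
      rw [e3, ← ih (by omega)]
      rcases h0 with ⟨a, b⟩ | ⟨a, b⟩ <;> rcases h1 with ⟨c, d⟩ | ⟨c, d⟩
      · rw [a, ← d, ← b, c]
      · rw [a, ← neg_inj, ← c, b, d]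
      · rw [a, ← d, ← c, b]
      · rw [a, ← neg_inj, neg_neg, ← c, b, d, neg_neg]
  exact step g le_rfl

/-- The restriction to the attaching circle of a map on the union of the `0`-handle and the
`1`-handles is even. -/
theorem evenLoop_attach_of_H01 {g : ℕ} (hg : 1 ≤ g) {a : Surface g → SO3}
    (ha : ContinuousOn a (H01 g)) : EvenLoop fun u => a (attach g u) := by
  have hg0 : (g : ℝ) ≠ 0 := by positivity
  have hρ : ∀ r : ℝ, max (1 / 2) (min r 1) ∈ Icc (0 : ℝ) 1 := fun r =>
    ⟨le_max_of_le_left (by norm_num), max_le (by norm_num) (min_le_right _ _)⟩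
  let c : ℝ × ℝ → UnitDisc := fun p => ⟨_, circlePt_mem g _ (hρ p.1) p.2⟩
  have hc : Continuous c := by
    have h1 : Continuous fun p : ℝ × ℝ => max (1 / 2) (min p.1 1) := by fun_prop
    have h2 : Continuous fun p : ℝ × ℝ => (circlePt g p.2 : ℂ) :=
      continuous_subtype_val.comp ((continuous_circlePt g).comp continuous_snd)
    exact (h1.smul h2).subtype_mk _
  have hcH : ∀ p, mk g (c p) ∈ H01 g := by
    intro p
    change 1 / 2 ≤ ‖(c p).1‖
    rw [norm_smul, Circle.norm_coe, mul_one, Real.norm_of_nonneg (hρ p.1).1]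
    exact le_max_left _ _
  obtain ⟨F, hF, hs⟩ := exists_spin_lift (f := fun p => a (mk g (c p)))
    (ha.comp_continuous ((continuous_mk g).comp hc) hcH)
  have hclosed : F (1, 4 * g) = F (1, 0) := by
    refine lift_boundary_closed (F := fun t => F (1, t)) (by fun_prop) fun j i s h => ?_
    rw [hs, hs]
    exact congrArg a (mk_circlePt_eq j i h (by norm_num [c]) (by norm_num [c]))
  have hper : ∀ p : ℝ × ℝ, F (p.1, p.2 + 4 * g) = F p := by
    refine spin_lift_eq (F := fun p : ℝ × ℝ => F (p.1, p.2 + 4 * g)) (by fun_prop) hF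
      (fun p => ?_) (a₀ := (1, 0)) (by simpa using hclosed)
    rw [hs, hs]
    congr 2
    refine Subtype.ext ?_
    simp [c, circlePt_add_period hg]
  refine .of_periodic (L := fun t => F (0, t * (4 * g) / (2 * Real.pi))) (by fun_prop)
    (fun t => ?_) fun t => ?_
  · rw [hs, attach]
    congr 2
    refine Subtype.ext ?_
    simp only [c]
    rw [circlePt_mul_div hg]
    norm_num [div_eq_inv_mul]
  · have e : (t + 2 * Real.pi) * (4 * g) / (2 * Real.pi) =
        t * (4 * g) / (2 * Real.pi) + 4 * g := by
      have := Real.pi_ne_zero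
      field_simp
    simp only [e]
    exact hper (0, t * (4 * g) / (2 * Real.pi))

/-- The restriction to the attaching circle of a map on the `2`-handle is even. -/
theorem evenLoop_attach_of_H2 {g : ℕ} {b : Surface g → SO3} (hb : ContinuousOn b (H2 g)) :
    EvenLoop fun u => b (attach g u) := by
  have hn : ∀ z : UnitDisc, ‖(1 / 2 : ℝ) • z.1‖ ≤ 1 / 2 := fun z => by
    have := mem_closedBall_zero_iff.1 z.2
    rw [norm_smul, Real.norm_of_nonneg (by norm_num)]
    linarith
  let h : UnitDisc → UnitDisc := fun z =>
    ⟨(1 / 2 : ℝ) • z.1, mem_closedBall_zero_iff.2 ((hn z).trans (by norm_num))⟩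
  have hh : Continuous h := Continuous.subtype_mk (by fun_prop) _
  refine .of_continuous_extension (E := fun z => b (mk g (h (discRetract z))))
    (hb.comp_continuous ((continuous_mk g).comp (hh.comp continuous_discRetract))
      fun z => hn _) fun u => ?_
  have hu : discRetract u = ⟨u, by simp [Circle.norm_coe]⟩ :=
    discRetract_coe ⟨(u : ℂ), by simp [Circle.norm_coe]⟩
  rw [attach]
  congr 2
  refine Subtype.ext ?_
  simp [h, hu, div_eq_inv_mul]

namespace Clutching

variable (g : ℕ) (φ : C(Circle, SO3))

theorem exists_chart_H01 : ∃ e ∈ atlas g φ, H01 g ⊆ e.baseSet ∧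
    ∀ p, (e (inOne g φ p)).2 = p.2 := by
  have hU : IsOpen {x : Surface g | 1 / 4 < radius x} :=
    isOpen_lt continuous_const continuous_radius
  refine ⟨_, chart_mem_atlas (fun _ => 1) (fun x => φ (angle g x)) hU continuousOn_const ?_
    (fun u => by rw [angle_attach, one_mul]), ?_, fun p => rotate_one _⟩
  · refine φ.continuous.comp_continuousOn ((continuousOn_angle g).mono ?_)
    rintro x ⟨hx, hx'⟩
    exact ⟨hx, lt_of_le_of_lt hx' (by norm_num)⟩
  · intro x hx
    exact lt_of_lt_of_le (by norm_num) (show 1 / 2 ≤ radius x from hx)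

theorem exists_chart_H2 : ∃ e ∈ atlas g φ, H2 g ⊆ e.baseSet ∧
    ∀ p, (e (inTwo g φ p)).2 = p.2 := by
  have hU : IsOpen {x : Surface g | radius x < 1} :=
    isOpen_lt continuous_radius continuous_const
  refine ⟨_, chart_mem_atlas (fun x => (φ (angle g x))⁻¹) (fun _ => 1) hU ?_ continuousOn_const
    (fun u => by rw [angle_attach, inv_mul_cancel]), ?_, fun p => rotate_one _⟩
  · refine SO3.continuous_inv.comp_continuousOn (φ.continuous.comp_continuousOn
      ((continuousOn_angle g).mono ?_))
    rintro x ⟨hx, hx'⟩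
    exact ⟨lt_of_lt_of_le (by norm_num) (show 1 / 2 ≤ radius x from hx'), hx⟩
  · intro x hx
    exact lt_of_le_of_lt (show radius x ≤ 1 / 2 from hx) (by norm_num)

theorem coord_attach {e₁ e₂ : Trivialization S2 (proj g φ)}
    (h₁ : ∀ p, (e₁ (inOne g φ p)).2 = p.2) (h₂ : ∀ p, (e₂ (inTwo g φ p)).2 = p.2)
    {x : Total g φ} {u : Circle} (hx : proj g φ x = attach g u) :
    (e₁ x).2 = rotate (φ u) (e₂ x).2 := by
  rcases exists_rep g φ x with ⟨⟨⟨b, hb⟩, y⟩, rfl⟩ | ⟨⟨⟨b, hb⟩, y⟩, rfl⟩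
  · obtain rfl : b = attach g u := hx
    have e : inOne g φ (⟨attach g u, hb⟩, y) =
        inTwo g φ (⟨attach g u, attach_mem_H2 g u⟩, rotate (φ u)⁻¹ y) := by
      rw [inTwo_eq_inOne, rotate_rotate_inv]
    rw [h₁, e, h₂, rotate_rotate_inv]
  · obtain rfl : b = attach g u := hx
    rw [h₂]
    have e := inTwo_eq_inOne g φ u y
    rw [e, h₁]

end Clutching

theorem trivialization_eq_of_snd_eq {B Z : Type*} [TopologicalSpace B] [TopologicalSpace Z]
    {F : Type*} [TopologicalSpace F] {p : Z → B} (e : Trivialization F p) {x y : Z}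
    (h : p x = p y) (hx : p x ∈ e.baseSet) (hxy : (e x).2 = (e y).2) : x = y := by
  refine e.injOn (e.mem_source.2 hx) (e.mem_source.2 (h ▸ hx)) (Prod.ext ?_ hxy)
  change (e x).1 = (e y).1
  rw [e.coe_fst' hx, e.coe_fst' (h ▸ hx), h]

/-- A fibrewise homeomorphism to the product carries three constant sections to three disjoint
sections of the clutched bundle. Their frames over the two pieces differ by `φ` on the attaching
circle. -/
theorem evenLoop_of_fibreHomeomorphic {g : ℕ} (hg : 1 ≤ g) (φ : C(Circle, SO3))
    (h : OrientableS2Bundle.FibreHomeomorphic (clutchedBundle g φ)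
      (OrientableS2Bundle.product (Surface g))) : EvenLoop φ := by
  obtain ⟨Ψ, hΨ⟩ := h
  have hpt : ∀ i : Fin 3, (EuclideanSpace.single i (1 : ℝ) : EuclideanSpace ℝ (Fin 3)) ∈
      Metric.sphere (0 : EuclideanSpace ℝ (Fin 3)) 1 := fun i => by simp
  let P : Fin 3 → S2 := fun i => ⟨_, hpt i⟩
  have hP : Function.Injective P := by
    intro i j hij
    by_contra hne
    have := congrArg (fun y : S2 => y.1 i) hij
    simp [P, hne] at this
  let s : Fin 3 → Surface g → Total g φ := fun i x => Ψ.symm (x, P i)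
  have hs : ∀ i, Continuous (s i) := fun i => Ψ.symm.continuous.comp (by fun_prop)
  have hps : ∀ i x, proj g φ (s i x) = x := by
    intro i x
    refine (hΨ (s i x)).symm.trans ?_
    exact congrArg (OrientableS2Bundle.product (Surface g)).proj (Ψ.apply_symm_apply (x, P i))
  have hsi : ∀ x, Function.Injective fun i => s i x := fun x i j hij =>
    hP (congrArg Prod.snd (Ψ.symm.injective hij))
  have key : ∀ (e : Trivialization S2 (proj g φ)) (K : Set (Surface g)), K ⊆ e.baseSet →
      (∀ x ∈ K, Function.Injective fun i => (e (s i x)).2) ∧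
      ContinuousOn (fun x => tripleFrame fun i => (e (s i x)).2) K := by
    intro e K hK
    have hi : ∀ x ∈ K, Function.Injective fun i => (e (s i x)).2 := fun x hx i j hij =>
      hsi x (trivialization_eq_of_snd_eq e ((hps i x).trans (hps j x).symm)
        ((hps i x).symm ▸ hK hx) hij)
    refine ⟨hi, continuousOn_tripleFrame (fun i => ?_) hi⟩
    have he : ContinuousOn (fun x => e (s i x)) K :=
      e.continuousOn_toFun.comp (hs i).continuousOn fun x hx =>
        e.mem_source.2 ((hps i x).symm ▸ hK hx)
    exact continuous_snd.comp_continuousOn he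
  obtain ⟨e₁, -, hb₁, h₁⟩ := exists_chart_H01 g φ
  obtain ⟨e₂, -, hb₂, h₂⟩ := exists_chart_H2 g φ
  obtain ⟨-, c₁⟩ := key e₁ _ hb₁
  obtain ⟨i₂, c₂⟩ := key e₂ _ hb₂
  have := (evenLoop_attach_of_H01 hg c₁).mul (evenLoop_attach_of_H2 c₂).inv
  convert this using 1
  funext u
  have e : (fun i => (e₁ (s i (attach g u))).2) =
      fun i => rotate (φ u) (e₂ (s i (attach g u))).2 :=
    funext fun i => coord_attach g φ h₁ h₂ (hps i _)
  simp only [e]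
  rw [tripleFrame_rotate _ (i₂ _ (attach_mem_H2 g u)), mul_inv_cancel_right]

/-! ### Frames of an orientable two-sphere bundle -/

namespace OrientableS2Bundle

variable {B : Type} [TopologicalSpace B]

theorem exists_rotate_trans (X : OrientableS2Bundle B) {e e' : Trivialization S2 X.proj}
    (he : e ∈ X.atlas) (he' : e' ∈ X.atlas) {b : B} (hb : b ∈ e.baseSet) (hb' : b ∈ e'.baseSet) :
    ∃ A : SO3, ∀ x, X.proj x = b → (e' x).2 = rotate A (e x).2 := by
  obtain ⟨τ, -, hτ⟩ := X.transition e he e' he'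
  refine ⟨τ b, fun x hx => ?_⟩
  subst hx
  exact hτ x ⟨hb, hb'⟩

/-- `h` is an admissible parametrization of the fibre over `b`: a rotation in every chart. -/
structure IsFibreFrame (X : OrientableS2Bundle B) (b : B) (h : S2 → X.total) : Prop where
  proj_eq : ∀ v, X.proj (h v) = b
  coord : ∀ e ∈ X.atlas, b ∈ e.baseSet → ∃ A : SO3, ∀ v, (e (h v)).2 = rotate A v

/-- `F` is a frame over `f` on `S`, that is, a section over `S` of the pullback along `f` of the
principal bundle that is associated with `X`: a continuous family of admissible parametrizations
of the fibres over the points `f y`. -/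
structure IsFrame (X : OrientableS2Bundle B) {Y : Type*} [TopologicalSpace Y] (f : Y → B)
    (S : Set Y) (F : Y → S2 → X.total) : Prop where
  fibre : ∀ y ∈ S, X.IsFibreFrame (f y) (F y)
  continuousOn : ∀ v, ContinuousOn (fun y => F y v) S

end OrientableS2Bundle

theorem continuousOn_of_rotate {Y : Type*} [TopologicalSpace Y] {α : Y → SO3} {s : Set Y}
    (h : ∀ v, ContinuousOn (fun y => rotate (α y) v) s) : ContinuousOn α s := by
  refine Topology.IsInducing.subtypeVal.continuousOn_iff.2 ?_
  refine continuousOn_pi.2 fun i => continuousOn_pi.2 fun j => ?_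
  have hj : (EuclideanSpace.single j (1 : ℝ) : EuclideanSpace ℝ (Fin 3)) ∈
      Metric.sphere (0 : EuclideanSpace ℝ (Fin 3)) 1 := by simp
  have hc : Continuous fun z : S2 => z.1 i := by fun_prop
  refine (hc.comp_continuousOn (h ⟨_, hj⟩)).congr fun y _ => ?_
  simp [rotate]

namespace OrientableS2Bundle

variable {B : Type} [TopologicalSpace B] {X : OrientableS2Bundle B}

theorem IsFibreFrame.rotate {b : B} {h : S2 → X.total} (hh : X.IsFibreFrame b h) (A : SO3) :
    X.IsFibreFrame b fun v => h (rotate A v) where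
  proj_eq v := hh.proj_eq _
  coord e he hb := by
    obtain ⟨C, hC⟩ := hh.coord e he hb
    exact ⟨C * A, fun v => by rw [hC, rotate_mul]⟩

theorem IsFibreFrame.injective {b : B} {h : S2 → X.total} (hh : X.IsFibreFrame b h) :
    Function.Injective h := by
  obtain ⟨e, he, hb⟩ := X.exists_mem_atlas b
  obtain ⟨C, hC⟩ := hh.coord e he hb
  intro v w hvw
  have := congrArg (fun x => (e x).2) hvw
  simp only [hC] at this
  exact rotate_injective C this

theorem IsFibreFrame.exists_eq {b : B} {h h' : S2 → X.total} (hh : X.IsFibreFrame b h)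
    (hh' : X.IsFibreFrame b h') : ∃ A : SO3, ∀ v, h' v = h (_root_.rotate A v) := by
  obtain ⟨e, he, hb⟩ := X.exists_mem_atlas b
  obtain ⟨C, hC⟩ := hh.coord e he hb
  obtain ⟨D, hD⟩ := hh'.coord e he hb
  refine ⟨C⁻¹ * D, fun v => trivialization_eq_of_snd_eq e ?_ ?_ ?_⟩
  · rw [hh.proj_eq, hh'.proj_eq]
  · rwa [hh'.proj_eq]
  · rw [hC, hD, ← rotate_mul, mul_inv_cancel_left]

section

variable {Y : Type*} [TopologicalSpace Y] {f : Y → B} {S : Set Y} {F : Y → S2 → X.total}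

theorem IsFrame.mono {T : Set Y} (h : X.IsFrame f S F) (hT : T ⊆ S) : X.IsFrame f T F :=
  ⟨fun y hy => h.fibre y (hT hy), fun v => (h.continuousOn v).mono hT⟩

theorem IsFrame.comp {Z : Type*} [TopologicalSpace Z] {T : Set Z} {k : Z → Y}
    (h : X.IsFrame f S F) (hk : ContinuousOn k T) (hT : MapsTo k T S) :
    X.IsFrame (fun z => f (k z)) T fun z => F (k z) :=
  ⟨fun _ hz => h.fibre _ (hT hz), fun v => (h.continuousOn v).comp hk hT⟩

theorem IsFrame.congr {f' : Y → B} {F' : Y → S2 → X.total} (h : X.IsFrame f S F)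
    (hf : ∀ y ∈ S, f' y = f y) (hF : ∀ y ∈ S, F' y = F y) : X.IsFrame f' S F' :=
  ⟨fun y hy => by rw [hf y hy, hF y hy]; exact h.fibre y hy,
    fun v => (h.continuousOn v).congr fun y hy => congrFun (hF y hy) v⟩

theorem IsFrame.union {T : Set Y} (h : X.IsFrame f S F) (h' : X.IsFrame f T F)
    (hS : IsClosed S) (hT : IsClosed T) : X.IsFrame f (S ∪ T) F where
  fibre y hy := hy.elim (h.fibre y) (h'.fibre y)
  continuousOn v := (h.continuousOn v).union_of_isClosed (h'.continuousOn v) hS hT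

/-- The coordinate of a frame in a chart. -/
theorem IsFrame.exists_coord (h : X.IsFrame f S F) {e : Trivialization S2 X.proj}
    (he : e ∈ X.atlas) : ∃ α : Y → SO3, ContinuousOn α (S ∩ f ⁻¹' e.baseSet) ∧
      ∀ y ∈ S ∩ f ⁻¹' e.baseSet, ∀ v, (e (F y v)).2 = rotate (α y) v := by
  have hex : ∀ y, ∃ A : SO3, y ∈ S ∩ f ⁻¹' e.baseSet → ∀ v, (e (F y v)).2 = rotate A v := by
    intro y
    by_cases hy : y ∈ S ∩ f ⁻¹' e.baseSet
    · obtain ⟨A, hA⟩ := (h.fibre y hy.1).coord e he hy.2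
      exact ⟨A, fun _ => hA⟩
    · exact ⟨1, fun hy' => absurd hy' hy⟩
  choose α hα using hex
  refine ⟨α, continuousOn_of_rotate fun v => ?_, hα⟩
  have hc : ContinuousOn (fun y => e (F y v)) (S ∩ f ⁻¹' e.baseSet) :=
    e.continuousOn_toFun.comp ((h.continuousOn v).mono inter_subset_left) fun y hy =>
      e.mem_source.2 (by rw [(h.fibre y hy.1).proj_eq]; exact hy.2)
  exact (continuous_snd.comp_continuousOn hc).congr fun y hy => (hα y hy v).symm

theorem IsFrame.continuousOn_apply (h : X.IsFrame f S F) (hf : ContinuousOn f S) {w : Y → S2}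
    (hw : ContinuousOn w S) : ContinuousOn (fun y => F y (w y)) S := by
  intro y hy
  obtain ⟨e, he, hb⟩ := X.exists_mem_atlas (f y)
  obtain ⟨α, hα, hαF⟩ := h.exists_coord he
  have hc : ContinuousOn (fun y => e.toOpenPartialHomeomorph.symm (f y, rotate (α y) (w y)))
      (S ∩ f ⁻¹' e.baseSet) := by
    refine e.toOpenPartialHomeomorph.continuousOn_invFun.comp
      ((hf.mono inter_subset_left).prodMk (continuous_rotate.comp_continuousOn
        (hα.prodMk (hw.mono inter_subset_left)))) fun y hy => e.mem_target.2 hy.2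
  have hc' : ContinuousOn (fun y => F y (w y)) (S ∩ f ⁻¹' e.baseSet) := by
    refine hc.congr fun y hy => ?_
    have hp := (h.fibre y hy.1).proj_eq (w y)
    have ht : (f y, rotate (α y) (w y)) ∈ e.target := e.mem_target.2 hy.2
    refine trivialization_eq_of_snd_eq e ?_ ?_ ?_
    · rw [hp, e.proj_symm_apply ht]
    · rw [hp]; exact hy.2
    · rw [hαF y hy, e.apply_symm_apply ht]
  refine (hc' y ⟨hy, hb⟩).mono_of_mem_nhdsWithin ?_
  exact Filter.inter_mem self_mem_nhdsWithin (hf y hy (e.open_baseSet.mem_nhds hb))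

theorem IsFrame.rotate (h : X.IsFrame f S F) (hf : ContinuousOn f S) {δ : Y → SO3}
    (hδ : ContinuousOn δ S) : X.IsFrame f S fun y v => F y (rotate (δ y) v) where
  fibre y hy := (h.fibre y hy).rotate (δ y)
  continuousOn _ := h.continuousOn_apply hf
    (continuous_rotate.comp_continuousOn (hδ.prodMk continuousOn_const))

/-- Two frames over the same map differ by a continuous map into the rotation group. -/
theorem IsFrame.exists_rotate_eq {G : Y → S2 → X.total} (h : X.IsFrame f S F)
    (h' : X.IsFrame f S G) (hf : ContinuousOn f S) :
    ∃ δ : Y → SO3, ContinuousOn δ S ∧ ∀ y ∈ S, ∀ v, G y v = F y (_root_.rotate (δ y) v) := by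
  have hex : ∀ y, ∃ A : SO3, y ∈ S → ∀ v, G y v = F y (_root_.rotate A v) := by
    intro y
    by_cases hy : y ∈ S
    · obtain ⟨A, hA⟩ := (h.fibre y hy).exists_eq (h'.fibre y hy)
      exact ⟨A, fun _ => hA⟩
    · exact ⟨1, fun hy' => absurd hy' hy⟩
  choose δ hδ using hex
  refine ⟨δ, fun y hy => ?_, hδ⟩
  obtain ⟨e, he, hb⟩ := X.exists_mem_atlas (f y)
  obtain ⟨α, hα, hαF⟩ := h.exists_coord he
  obtain ⟨β, hβ, hβG⟩ := h'.exists_coord he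
  have hc : ContinuousOn δ (S ∩ f ⁻¹' e.baseSet) := by
    refine ((SO3.continuous_inv.comp_continuousOn hα).mul hβ).congr fun y hy => ?_
    refine rotate_faithful fun v => ?_
    have h1 := hβG y hy v
    rw [hδ y hy.1, hαF y hy] at h1
    change _ = _root_.rotate ((α y)⁻¹ * β y) v
    rw [rotate_mul, ← h1, rotate_inv_rotate]
  refine (hc y ⟨hy, hb⟩).mono_of_mem_nhdsWithin ?_
  exact Filter.inter_mem self_mem_nhdsWithin (hf y hy (e.open_baseSet.mem_nhds hb))

theorem exists_isFrame_of_mapsTo {e : Trivialization S2 X.proj} (he : e ∈ X.atlas)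
    (hf : ContinuousOn f S) (hS : MapsTo f S e.baseSet) : ∃ F, X.IsFrame f S F := by
  refine ⟨fun y v => e.toOpenPartialHomeomorph.symm (f y, v), fun y hy => ?_, fun v => ?_⟩
  · have ht : ∀ v, (f y, v) ∈ e.target := fun v => e.mem_target.2 (hS hy)
    refine ⟨fun v => e.proj_symm_apply (ht v), fun e' he' hb => ?_⟩
    obtain ⟨A, hA⟩ := X.exists_rotate_trans he he' (hS hy) hb
    refine ⟨A, fun v => ?_⟩
    rw [hA _ (e.proj_symm_apply (ht v)), e.apply_symm_apply (ht v)]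
  · exact e.toOpenPartialHomeomorph.continuousOn_invFun.comp (hf.prodMk continuousOn_const)
      fun y hy => e.mem_target.2 (hS hy)

/-- Frames over two closed sets can be glued after a correction of the second one, if the second
set retracts to the intersection. -/
theorem exists_isFrame_union {C D : Set Y} (hf : Continuous f) (hC : IsClosed C)
    (hD : IsClosed D) {ρ : Y → Y} (hρ : Continuous ρ) (hρm : MapsTo ρ D (C ∩ D))
    (hρe : ∀ y ∈ C ∩ D, ρ y = y) (h : ∃ F, X.IsFrame f C F) (h' : ∃ F, X.IsFrame f D F) :
    ∃ F, X.IsFrame f (C ∪ D) F := by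
  classical
  obtain ⟨F, hF⟩ := h
  obtain ⟨G, hG⟩ := h'
  obtain ⟨δ, hδ, hδe⟩ := (hG.mono inter_subset_right).exists_rotate_eq
    (hF.mono (inter_subset_left (t := D))) hf.continuousOn
  have hG' := hG.rotate hf.continuousOn (hδ.comp hρ.continuousOn hρm)
  refine ⟨fun y => if y ∈ C then F y else fun v => G y (_root_.rotate (δ (ρ y)) v),
    (hF.congr (fun _ _ => rfl) fun _ hy => if_pos hy).union
    (hG'.congr (fun _ _ => rfl) fun y hy => ?_) hC hD⟩
  split_ifs with hy'
  · funext v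
    rw [hδe y ⟨hy', hy⟩, Function.comp_apply, hρe y ⟨hy', hy⟩]
  · rfl

end

/-- Every bundle has a frame over every map from the unit square. -/
theorem exists_isFrame_square {f : unitInterval × unitInterval → B} (hf : Continuous f) :
    ∃ F, X.IsFrame f univ F := by
  obtain ⟨t, t0, hmono, ⟨N, hN⟩, ht⟩ := exists_monotone_Icc_subset_open_cover_unitInterval_prod_self
    (c := fun e : X.atlas => f ⁻¹' e.1.baseSet) (fun e => e.1.open_baseSet.preimage hf) fun p _ => by
      obtain ⟨e, he, hb⟩ := X.exists_mem_atlas (f p)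
      exact mem_iUnion.2 ⟨⟨e, he⟩, hb⟩
  have hcell : ∀ n m, ∃ F, X.IsFrame f (Icc (t n) (t (n + 1)) ×ˢ Icc (t m) (t (m + 1))) F := by
    intro n m
    obtain ⟨e, he⟩ := ht n m
    exact exists_isFrame_of_mapsTo e.2 hf.continuousOn he
  have hrow : ∀ m n, ∃ F, X.IsFrame f (Icc 0 (t n) ×ˢ Icc (t m) (t (m + 1))) F := by
    intro m n
    induction n with
    | zero =>
      obtain ⟨F, hF⟩ := hcell 0 m
      refine ⟨F, hF.mono (prod_mono ?_ le_rfl)⟩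
      rw [t0]
      exact Icc_subset_Icc_right (unitInterval.nonneg _)
    | succ n ih =>
      have := exists_isFrame_union hf (isClosed_Icc.prod isClosed_Icc)
        (isClosed_Icc.prod isClosed_Icc) (ρ := fun p => (t n, p.2)) (by fun_prop) ?_ ?_ ih
        (hcell n m)
      · rwa [← union_prod, Icc_union_Icc_eq_Icc (show 0 ≤ t n from (t n).2.1) (hmono n.le_succ)] at this
      · intro p hp
        exact ⟨⟨⟨unitInterval.nonneg _, le_rfl⟩, hp.2⟩, ⟨⟨le_rfl, hmono n.le_succ⟩, hp.2⟩⟩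
      · intro p hp
        exact Prod.ext (le_antisymm hp.2.1.1 hp.1.1.2) rfl
  have hrow' : ∀ m, ∃ F, X.IsFrame f (univ ×ˢ Icc (t m) (t (m + 1))) F := by
    intro m
    have h := hrow m N
    rwa [hN N le_rfl, show Icc (0 : unitInterval) 1 = univ from Icc_bot_top] at h
  have hall : ∀ m, ∃ F, X.IsFrame f (univ ×ˢ Icc 0 (t m)) F := by
    intro m
    induction m with
    | zero =>
      obtain ⟨F, hF⟩ := hrow' 0
      refine ⟨F, hF.mono (prod_mono le_rfl ?_)⟩
      rw [t0]
      exact Icc_subset_Icc_right (unitInterval.nonneg _)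
    | succ m ih =>
      have := exists_isFrame_union hf (isClosed_univ.prod isClosed_Icc)
        (isClosed_univ.prod isClosed_Icc) (ρ := fun p => (p.1, t m)) (by fun_prop) ?_ ?_ ih
        (hrow' m)
      · rwa [← prod_union, Icc_union_Icc_eq_Icc (show 0 ≤ t m from (t m).2.1) (hmono m.le_succ)] at this
      · intro p hp
        exact ⟨⟨hp.1, ⟨unitInterval.nonneg _, le_rfl⟩⟩, ⟨hp.1, ⟨le_rfl, hmono m.le_succ⟩⟩⟩
      · intro p hp
        exact Prod.ext rfl (le_antisymm hp.2.2.1 hp.1.2.2)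
  have h := hall N
  rwa [hN N le_rfl, show Icc (0 : unitInterval) 1 = univ from Icc_bot_top, univ_prod_univ] at h

/-- Every bundle has a frame over every map from the disc, which is a retract of a square. -/
theorem exists_isFrame_disc {f : UnitDisc → B} (hf : Continuous f) :
    ∃ F, X.IsFrame f univ F := by
  let k : unitInterval × unitInterval → UnitDisc := fun p =>
    discRetract (((2 * (p.1 : ℝ) - 1 : ℝ) : ℂ) + ((2 * (p.2 : ℝ) - 1 : ℝ) : ℂ) * Complex.I)
  have hk : Continuous k := continuous_discRetract.comp (by fun_prop)
  have hre : ∀ z : UnitDisc, |z.1.re| ≤ 1 := fun z =>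
    (Complex.abs_re_le_norm _).trans (mem_closedBall_zero_iff.1 z.2)
  have him : ∀ z : UnitDisc, |z.1.im| ≤ 1 := fun z =>
    (Complex.abs_im_le_norm _).trans (mem_closedBall_zero_iff.1 z.2)
  let l : UnitDisc → unitInterval × unitInterval := fun z =>
    (⟨(z.1.re + 1) / 2, by have := abs_le.1 (hre z); constructor <;> linarith⟩,
      ⟨(z.1.im + 1) / 2, by have := abs_le.1 (him z); constructor <;> linarith⟩)
  have hl : Continuous l := by
    refine Continuous.prodMk (Continuous.subtype_mk ?_ _) (Continuous.subtype_mk ?_ _) <;> fun_prop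
  have hkl : ∀ z, k (l z) = z := by
    intro z
    conv_rhs => rw [← discRetract_coe z]
    simp only [k, l]
    congr 1
    apply Complex.ext <;> simp <;> ring
  obtain ⟨F, hF⟩ := exists_isFrame_square (X := X) (hf.comp hk)
  exact ⟨_, (hF.comp hl.continuousOn (mapsTo_univ _ _)).congr
    (fun z _ => by rw [Function.comp_apply, hkl]) fun _ _ => rfl⟩

/-- A continuous fibre-preserving map that is a rotation of every fibre is an isomorphism. -/
theorem Iso.of_continuous {X Y : OrientableS2Bundle B} {Ψ : X.total → Y.total}
    (hΨ : Continuous Ψ) (hp : ∀ x, Y.proj (Ψ x) = X.proj x)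
    (h : ∀ e ∈ X.atlas, ∀ e' ∈ Y.atlas, ∀ b ∈ e.baseSet ∩ e'.baseSet, ∃ A : SO3,
      ∀ x, X.proj x = b → (e' (Ψ x)).2 = rotate A (e x).2) : Iso X Y := by
  have hα : ∀ e ∈ X.atlas, ∀ e' ∈ Y.atlas, ∃ α : B → SO3,
      ContinuousOn α (e.baseSet ∩ e'.baseSet) ∧
      ∀ x, X.proj x ∈ e.baseSet ∩ e'.baseSet →
        (e' (Ψ x)).2 = rotate (α (X.proj x)) (e x).2 := by
    intro e he e' he'
    have hex : ∀ b, ∃ A : SO3, b ∈ e.baseSet ∩ e'.baseSet →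
        ∀ x, X.proj x = b → (e' (Ψ x)).2 = rotate A (e x).2 := by
      intro b
      by_cases hb : b ∈ e.baseSet ∩ e'.baseSet
      · obtain ⟨A, hA⟩ := h e he e' he' b hb
        exact ⟨A, fun _ => hA⟩
      · exact ⟨1, fun hb' => absurd hb' hb⟩
    choose α hα using hex
    refine ⟨α, continuousOn_of_rotate fun v => ?_, fun x hx => hα _ hx x rfl⟩
    have ht : ∀ b ∈ e.baseSet ∩ e'.baseSet, (b, v) ∈ e.target := fun b hb => e.mem_target.2 hb.1
    have hc : ContinuousOn (fun b => e' (Ψ (e.toOpenPartialHomeomorph.symm (b, v))))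
        (e.baseSet ∩ e'.baseSet) :=
      e'.continuousOn_toFun.comp (hΨ.comp_continuousOn
        (e.toOpenPartialHomeomorph.continuousOn_invFun.comp (by fun_prop) ht)) fun b hb =>
        e'.mem_source.2 (by rw [hp, e.proj_symm_apply (ht b hb)]; exact hb.2)
    refine (continuous_snd.comp_continuousOn hc).congr fun b hb => ?_
    have := hα b hb _ (e.proj_symm_apply (ht b hb))
    rw [e.apply_symm_apply (ht b hb)] at this
    exact this.symm
  have hinj : Function.Injective Ψ := by
    intro x y hxy
    have hpr : X.proj x = X.proj y := by rw [← hp, ← hp, hxy]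
    obtain ⟨e, he, hb⟩ := X.exists_mem_atlas (X.proj x)
    obtain ⟨e', he', hb'⟩ := Y.exists_mem_atlas (X.proj x)
    obtain ⟨A, hA⟩ := h e he e' he' _ ⟨hb, hb'⟩
    refine trivialization_eq_of_snd_eq e hpr hb (rotate_injective A ?_)
    rw [← hA x rfl, ← hA y hpr.symm, hxy]
  have hinv : ∀ y, ∀ e ∈ X.atlas, ∀ e' ∈ Y.atlas, ∀ A : SO3, Y.proj y ∈ e.baseSet →
      Y.proj y ∈ e'.baseSet → (∀ x, X.proj x = Y.proj y → (e' (Ψ x)).2 = rotate A (e x).2) →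
      Ψ (e.toOpenPartialHomeomorph.symm (Y.proj y, rotate A⁻¹ (e' y).2)) = y := by
    intro y e he e' he' A hb hb' hA
    have ht : (Y.proj y, rotate A⁻¹ (e' y).2) ∈ e.target := e.mem_target.2 hb
    have hpx : X.proj (e.toOpenPartialHomeomorph.symm (Y.proj y, rotate A⁻¹ (e' y).2)) =
      Y.proj y := e.proj_symm_apply ht
    refine trivialization_eq_of_snd_eq e' ?_ ?_ ?_
    · rw [hp, hpx]
    · rwa [hp, hpx]
    · rw [hA _ hpx, e.apply_symm_apply ht, rotate_rotate_inv]
  have hsurj : Function.Surjective Ψ := by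
    intro y
    obtain ⟨e, he, hb⟩ := X.exists_mem_atlas (Y.proj y)
    obtain ⟨e', he', hb'⟩ := Y.exists_mem_atlas (Y.proj y)
    obtain ⟨A, hA⟩ := h e he e' he' _ ⟨hb, hb'⟩
    exact ⟨_, hinv y e he e' he' A hb hb' hA⟩
  let Φ := Equiv.ofBijective Ψ ⟨hinj, hsurj⟩
  have hcont : Continuous Φ.symm := by
    refine continuous_iff_continuousAt.2 fun y => ?_
    obtain ⟨e, he, hb⟩ := X.exists_mem_atlas (Y.proj y)
    obtain ⟨e', he', hb'⟩ := Y.exists_mem_atlas (Y.proj y)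
    obtain ⟨α, hαc, hαx⟩ := hα e he e' he'
    have hcp : ContinuousOn Y.proj e'.source := e'.continuousOn_proj
    have hs : e'.source ∩ Y.proj ⁻¹' e.baseSet ∈ nhds y := by
      have hopen := hcp.isOpen_inter_preimage e'.open_source e.open_baseSet
      exact hopen.mem_nhds ⟨e'.mem_source.2 hb', hb⟩
    have hc : ContinuousOn (fun y => e.toOpenPartialHomeomorph.symm
        (Y.proj y, rotate (α (Y.proj y))⁻¹ (e' y).2)) (e'.source ∩ Y.proj ⁻¹' e.baseSet) := by
      have h1 : ContinuousOn Y.proj (e'.source ∩ Y.proj ⁻¹' e.baseSet) :=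
        hcp.mono inter_subset_left
      have h2 : ContinuousOn (fun y => α (Y.proj y)) (e'.source ∩ Y.proj ⁻¹' e.baseSet) :=
        hαc.comp h1 fun y hy => ⟨hy.2, e'.mem_source.1 hy.1⟩
      have h3 : ContinuousOn (fun y => (e' y).2) (e'.source ∩ Y.proj ⁻¹' e.baseSet) :=
        continuous_snd.comp_continuousOn (e'.continuousOn_toFun.mono inter_subset_left)
      exact e.toOpenPartialHomeomorph.continuousOn_invFun.comp
        (h1.prodMk (continuous_rotate.comp_continuousOn
          ((SO3.continuous_inv.comp_continuousOn h2).prodMk h3)))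
        fun y hy => e.mem_target.2 hy.2
    refine (hc.continuousAt hs).congr ?_
    filter_upwards [hs] with z hz
    refine hinj ((hinv z e he e' he' _ hz.2 (e'.mem_source.1 hz.1) fun x hx => ?_).trans
      (Φ.apply_symm_apply z).symm)
    rw [← hx]
    exact hαx x (by rw [hx]; exact ⟨hz.2, e'.mem_source.1 hz.1⟩)
  exact ⟨⟨Φ, hΨ, hcont⟩, hp, hα⟩

end OrientableS2Bundle

open Surface Clutching OrientableS2Bundle

/-- A bundle with frames over the two pieces that differ by `φ` on the attaching circle is the
clutched bundle of `φ`. -/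
theorem iso_clutchedBundle {g : ℕ} {φ : C(Circle, SO3)} {X : OrientableS2Bundle (Surface g)}
    {F₁ F₂ : Surface g → S2 → X.total} (h₁ : X.IsFrame id (H01 g) F₁)
    (h₂ : X.IsFrame id (H2 g) F₂)
    (h : ∀ u v, F₁ (attach g u) (rotate (φ u) v) = F₂ (attach g u) v) :
    Iso X (clutchedBundle g φ) := by
  refine Iso.symm ?_
  let Ψ : Clutching.Total g φ → X.total :=
    Quot.lift (Sum.elim (fun p => F₁ p.1 p.2) (fun p => F₂ p.1 p.2)) (by
      rintro _ _ ⟨u, y⟩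
      exact (h u y).symm)
  have hc₁ : Continuous fun p : H01 g × S2 => F₁ p.1 p.2 := by
    have := (h₁.comp (T := univ) (k := fun p : H01 g × S2 => p.1.1) (by fun_prop)
      fun p _ => p.1.2).continuousOn_apply (w := Prod.snd) (by fun_prop) (by fun_prop)
    exact continuousOn_univ.1 this
  have hc₂ : Continuous fun p : H2 g × S2 => F₂ p.1 p.2 := by
    have := (h₂.comp (T := univ) (k := fun p : H2 g × S2 => p.1.1) (by fun_prop)
      fun p _ => p.1.2).continuousOn_apply (w := Prod.snd) (by fun_prop) (by fun_prop)
    exact continuousOn_univ.1 this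
  refine Iso.of_continuous (X := clutchedBundle g φ) (Ψ := Ψ)
    (continuous_quot_lift _ (hc₁.sumElim hc₂)) ?_ ?_
  · intro x
    rcases exists_rep g φ x with ⟨p, rfl⟩ | ⟨p, rfl⟩
    · exact (h₁.fibre p.1 p.1.2).proj_eq p.2
    · exact (h₂.fibre p.1 p.1.2).proj_eq p.2
  · rintro e ⟨⟨σ₁, -, hσ₁⟩, ⟨σ₂, -, hσ₂⟩⟩ e' he' b ⟨hb, hb'⟩
    by_cases hbH : b ∈ H01 g
    · obtain ⟨A, hA⟩ := (h₁.fibre b hbH).coord e' he' hb'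
      have key : ∀ y, (e' (Ψ (inOne g φ (⟨b, hbH⟩, y)))).2 =
          rotate (A * (σ₁ b)⁻¹) (e (inOne g φ (⟨b, hbH⟩, y))).2 := by
        intro y
        refine (hA y).trans (Eq.trans ?_
          (congrArg (rotate (A * (σ₁ b)⁻¹)) (hσ₁ (⟨b, hbH⟩, y) hb).symm))
        rw [rotate_mul, rotate_inv_rotate]
      refine ⟨A * (σ₁ b)⁻¹, fun x hx => ?_⟩
      rcases exists_rep g φ x with ⟨⟨⟨c, hc⟩, y⟩, rfl⟩ | ⟨⟨⟨c, hc⟩, y⟩, rfl⟩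
      · obtain rfl : c = b := hx
        exact key y
      · obtain rfl : c = b := hx
        obtain ⟨u, rfl⟩ := exists_attach g hbH hc
        rw [inTwo_eq_inOne]
        exact key _
    · obtain ⟨A, hA⟩ := (h₂.fibre b (mem_H2_of_notMem_H01 g hbH)).coord e' he' hb'
      refine ⟨A * (σ₂ b)⁻¹, fun x hx => ?_⟩
      rcases exists_rep g φ x with ⟨⟨⟨c, hc⟩, y⟩, rfl⟩ | ⟨⟨⟨c, hc⟩, y⟩, rfl⟩
      · obtain rfl : c = b := hx
        exact absurd hc hbH
      · obtain rfl : c = b := hx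
        refine (hA y).trans (Eq.trans ?_
          (congrArg (rotate (A * (σ₂ c)⁻¹)) (hσ₂ (⟨c, hc⟩, y) hb).symm))
        rw [rotate_mul, rotate_inv_rotate]

theorem product_iso_clutchedBundle_one (g : ℕ) :
    Iso (product (Surface g)) (clutchedBundle g 1) := by
  have hF : ∀ S, (product (Surface g)).IsFrame id S fun x v => (x, v) := by
    intro S
    refine ⟨fun x _ => ⟨fun v => rfl, ?_⟩, fun v => ?_⟩
    · rintro e rfl -
      exact ⟨1, fun v => (rotate_one v).symm⟩
    · exact (Continuous.prodMk continuous_id continuous_const :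
        Continuous fun x : Surface g => (x, v)).continuousOn
  exact iso_clutchedBundle (hF _) (hF _) fun u v => congrArg (Prod.mk _) (rotate_one v)

/-! ### Trivialization over the handles and classification -/

open Surface Clutching OrientableS2Bundle

/-- The boundary point of the polygon that is reached after `t` sides. -/
noncomputable def boundaryPt (g : ℕ) (t : ℝ) : UnitDisc :=
  ⟨circlePt g t, by simp [Circle.norm_coe]⟩

theorem continuous_boundaryPt (g : ℕ) : Continuous (boundaryPt g) :=
  Continuous.subtype_mk (continuous_subtype_val.comp (continuous_circlePt g)) _

theorem mk_boundaryPt_side {g : ℕ} (j : Fin g) (c : Fin 2) {s : ℝ} (hs : s ∈ Icc (0 : ℝ) 1) :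
    mk g (boundaryPt g (4 * (j : ℕ) + (c : ℕ) + s)) =
      mk g (boundaryPt g (4 * (j : ℕ) + (c : ℕ) + 3 - s)) :=
  mk_circlePt_eq j c hs rfl rfl

/-- All corners of the polygon are the same point of the surface. -/
theorem mk_boundaryPt_corner {g k : ℕ} (hk : k ≤ 4 * g) :
    mk g (boundaryPt g k) = mk g (boundaryPt g 0) := by
  have h0 : ∀ (j : Fin g) (c : Fin 2), mk g (boundaryPt g (4 * (j : ℕ) + (c : ℕ))) =
      mk g (boundaryPt g (4 * (j : ℕ) + (c : ℕ) + 3)) := fun j c => by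
    simpa using mk_boundaryPt_side j c (s := 0) (by simp)
  have h1 : ∀ (j : Fin g) (c : Fin 2), mk g (boundaryPt g (4 * (j : ℕ) + (c : ℕ) + 1)) =
      mk g (boundaryPt g (4 * (j : ℕ) + (c : ℕ) + 2)) := fun j c => by
    have := mk_boundaryPt_side j c (s := 1) (by simp)
    rwa [show (4 * (j : ℕ) + (c : ℕ) + 3 - 1 : ℝ) = 4 * (j : ℕ) + (c : ℕ) + 2 by ring] at this
  have hstep : ∀ n : ℕ, n < g → ∀ i : ℕ, i ≤ 4 →
      mk g (boundaryPt g ((4 * n + i : ℕ) : ℝ)) = mk g (boundaryPt g ((4 * n : ℕ) : ℝ)) := by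
    intro n hn
    have a0 := h0 ⟨n, hn⟩ 0
    have a1 := h1 ⟨n, hn⟩ 0
    have b0 := h0 ⟨n, hn⟩ 1
    have b1 := h1 ⟨n, hn⟩ 1
    have e1 : (4 * (n : ℝ) + 1 + 1) = 4 * n + 2 := by ring
    have e2 : (4 * (n : ℝ) + 1 + 2) = 4 * n + 3 := by ring
    have e3 : (4 * (n : ℝ) + 1 + 3) = 4 * n + 4 := by ring
    simp only [Fin.coe_ofNat_eq_mod, Nat.zero_mod, Nat.cast_zero, add_zero, Nat.one_mod,
      Nat.cast_one, e1, e2, e3] at a0 a1 b0 b1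
    intro i hi
    interval_cases i <;> push_cast
    · simp
    · rw [a1, b1, a0]
    · rw [b1, a0]
    · rw [a0]
    · rw [← b0, a1, b1, a0]
  have hall : ∀ n : ℕ, n ≤ g → mk g (boundaryPt g ((4 * n : ℕ) : ℝ)) = mk g (boundaryPt g 0) := by
    intro n
    induction n with
    | zero => simp
    | succ n ih =>
      intro hn
      rw [← ih (by omega), ← hstep n hn 4 le_rfl]
      norm_num [mul_add]
  obtain hk' | hk' := hk.lt_or_eq
  · rw [← hall (k / 4) (by omega), ← hstep (k / 4) (by omega) (k % 4) (by omega), Nat.div_add_mod]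
  · rw [hk', hall g le_rfl]

namespace OrientableS2Bundle

variable {B : Type} [TopologicalSpace B] {X : OrientableS2Bundle B}

/-- Frames over consecutive unit intervals that agree at all endpoints form one frame. -/
theorem isFrame_concat {f : ℝ → B} {D : ℕ → ℝ → S2 → X.total} {f₀ : S2 → X.total} {n : ℕ}
    (h0 : X.IsFibreFrame (f 0) f₀) (hD0 : ∀ m, D m 0 = f₀) (hD1 : ∀ m, D m 1 = f₀)
    (hD : ∀ m < n, X.IsFrame (fun s => f (m + s)) (Icc 0 1) (D m)) :
    ∃ G : ℝ → S2 → X.total, X.IsFrame f (Icc 0 n) G ∧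
      ∀ (m : ℕ), ∀ s ∈ Icc (0 : ℝ) 1, G (m + s) = D m s := by
  let G : ℝ → S2 → X.total := fun t => D ⌊t⌋₊ (t - ⌊t⌋₊)
  have hG : ∀ (m : ℕ), ∀ s ∈ Icc (0 : ℝ) 1, G (m + s) = D m s := by
    rintro m s ⟨hs0, hs1⟩
    obtain hs | rfl := hs1.lt_or_eq
    · have : ⌊(m : ℝ) + s⌋₊ = m :=
        (Nat.floor_eq_iff (by positivity)).2 ⟨by linarith, by linarith⟩
      simp only [G, this, add_sub_cancel_left]
    · have : ⌊(m : ℝ) + 1⌋₊ = m + 1 := by exact_mod_cast Nat.floor_natCast (m + 1)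
      simp only [G, this, Nat.cast_add, Nat.cast_one, sub_self, hD0, hD1]
  refine ⟨G, ?_, hG⟩
  have key : ∀ k ≤ n, X.IsFrame f (Icc 0 k) G := by
    intro k
    induction k with
    | zero =>
      intro _
      rw [Nat.cast_zero, Icc_self]
      refine ⟨?_, fun v => continuousOn_singleton _ _⟩
      rintro _ rfl
      have : G 0 = f₀ := by simp [G, hD0]
      rwa [this]
    | succ k ih =>
      intro hk
      have h1 := (hD k hk).comp (T := Icc (k : ℝ) (k + 1)) (k := fun t => t - k) (by fun_prop)
        fun t ht => ⟨by linarith [ht.1], by linarith [ht.2]⟩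
      have h2 : X.IsFrame f (Icc (k : ℝ) (k + 1)) G := by
        refine h1.congr (fun t _ => by simp) fun t ht => ?_
        rw [← hG k (t - k) ⟨by linarith [ht.1], by linarith [ht.2]⟩, add_sub_cancel]
      have := (ih (by omega)).union h2 isClosed_Icc isClosed_Icc
      rwa [Icc_union_Icc_eq_Icc (by positivity) (by linarith), ← Nat.cast_succ] at this
  exact key n le_rfl

/-- A frame over a path whose endpoints have the same image can be corrected to a frame with
prescribed values at both endpoints. -/
theorem IsFrame.exists_endpoints {f : ℝ → B} (hf : Continuous f) {F : ℝ → S2 → X.total}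
    (hF : X.IsFrame f (Icc 0 1) F) {f₀ f₁ : S2 → X.total} (h₀ : X.IsFibreFrame (f 0) f₀)
    (h₁ : X.IsFibreFrame (f 1) f₁) :
    ∃ E : ℝ → S2 → X.total, X.IsFrame f (Icc 0 1) E ∧ E 0 = f₀ ∧ E 1 = f₁ := by
  obtain ⟨A, hA⟩ := (hF.fibre 0 (by simp)).exists_eq h₀
  obtain ⟨C, hC⟩ := (hF.fibre 1 (by simp)).exists_eq h₁
  let β := PathConnectedSpace.somePath A C
  refine ⟨_, hF.rotate hf.continuousOn (δ := β.extend) β.continuous_extend.continuousOn,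
    funext fun v => ?_, funext fun v => ?_⟩
  · simp [hA]
  · simp [hC]

end OrientableS2Bundle

/-- A frame over the boundary of the polygon that is compatible with the side identifications. On
the first side of each pair it is obtained from a path in the connected group `SO(3)`, on the
second side it is copied from the first. -/
theorem exists_isFrame_boundary {g : ℕ} {X : OrientableS2Bundle (Surface g)}
    {F : UnitDisc → S2 → X.total} (hF : X.IsFrame (mk g) univ F) :
    ∃ G : ℝ → S2 → X.total,
      X.IsFrame (fun t => mk g (boundaryPt g t)) (Icc 0 ((4 * g : ℕ) : ℝ)) G ∧
      (∀ k : ℕ, G k = F (boundaryPt g 0)) ∧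
      ∀ (j : Fin g) (c : Fin 2), ∀ s ∈ Icc (0 : ℝ) 1,
        G (4 * (j : ℕ) + (c : ℕ) + s) = G (4 * (j : ℕ) + (c : ℕ) + 3 - s) := by
  have hfc : Continuous fun t => mk g (boundaryPt g t) :=
    (continuous_mk g).comp (continuous_boundaryPt g)
  have h0 : X.IsFibreFrame (mk g (boundaryPt g 0)) (F (boundaryPt g 0)) := hF.fibre _ (mem_univ _)
  have hE : ∀ k : ℕ, ∃ E : ℝ → S2 → X.total, E 0 = F (boundaryPt g 0) ∧
      E 1 = F (boundaryPt g 0) ∧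
      (k < 4 * g → X.IsFrame (fun s => mk g (boundaryPt g (k + s))) (Icc 0 1) E) := by
    intro k
    by_cases hk : k < 4 * g
    · have hFk := hF.comp (T := Icc (0 : ℝ) 1) (k := fun s => boundaryPt g (k + s))
        ((continuous_boundaryPt g).comp (by fun_prop)).continuousOn (mapsTo_univ _ _)
      have hk0 : X.IsFibreFrame (mk g (boundaryPt g (k + 0))) (F (boundaryPt g 0)) := by
        rwa [add_zero, mk_boundaryPt_corner hk.le]
      have hk1 : X.IsFibreFrame (mk g (boundaryPt g (k + 1))) (F (boundaryPt g 0)) := by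
        rwa [← Nat.cast_succ, mk_boundaryPt_corner hk]
      obtain ⟨E, hE, e0, e1⟩ := hFk.exists_endpoints (hfc.comp (by fun_prop)) hk0 hk1
      exact ⟨E, e0, e1, fun _ => hE⟩
    · exact ⟨fun _ => F (boundaryPt g 0), rfl, rfl, fun h => absurd h hk⟩
  choose E hE0 hE1 hE using hE
  let D : ℕ → ℝ → S2 → X.total := fun m s => if m % 4 < 2 then E m s else E (m - 2) (1 - s)
  have hD0 : ∀ m, D m 0 = F (boundaryPt g 0) := by
    intro m
    simp only [D]
    split_ifs <;> simp [hE0, hE1]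
  have hD1 : ∀ m, D m 1 = F (boundaryPt g 0) := by
    intro m
    simp only [D]
    split_ifs <;> simp [hE0, hE1]
  obtain ⟨G, hG, hGD⟩ := isFrame_concat (f := fun t => mk g (boundaryPt g t)) (n := 4 * g) h0 hD0
    hD1 (fun m hm => by
      by_cases hm4 : m % 4 < 2
      · exact (hE m hm).congr (fun _ _ => rfl) fun s _ => if_pos hm4
      · have h1 := (hE (m - 2) (by omega)).comp (T := Icc (0 : ℝ) 1) (k := fun s => 1 - s)
          (by fun_prop) fun s hs => ⟨by linarith [hs.2], by linarith [hs.1]⟩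
        refine h1.congr (fun s hs => ?_) fun s _ => if_neg hm4
        have hside := mk_boundaryPt_side (g := g) ⟨m / 4, by omega⟩ ⟨m % 4 - 2, by omega⟩
          (s := 1 - s) ⟨by linarith [hs.2], by linarith [hs.1]⟩
        have hm2 : m - 2 = 4 * (m / 4) + (m % 4 - 2) := by omega
        have hm3 : m = 4 * (m / 4) + (m % 4 - 2) + 2 := by omega
        have hR2 : ((m - 2 : ℕ) : ℝ) = 4 * ((m / 4 : ℕ) : ℝ) + ((m % 4 - 2 : ℕ) : ℝ) := by
          exact_mod_cast hm2
        have hR3 : (m : ℝ) = 4 * ((m / 4 : ℕ) : ℝ) + ((m % 4 - 2 : ℕ) : ℝ) + 2 := by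
          exact_mod_cast hm3
        rw [hR2]
        refine Eq.trans ?_ hside.symm
        congr 2
        rw [hR3]
        ring)
  refine ⟨G, hG, fun k => ?_, fun j c s hs => ?_⟩
  · have := hGD k 0 (by simp)
    rwa [add_zero, hD0] at this
  · have h1 := hGD (4 * j + c) s hs
    have h2 := hGD (4 * j + c + 2) (1 - s) ⟨by linarith [hs.2], by linarith [hs.1]⟩
    have hc := c.2
    simp only [D] at h1 h2
    rw [if_pos (by omega)] at h1
    rw [if_neg (by omega), Nat.add_sub_cancel, sub_sub_cancel] at h2
    push_cast at h1 h2
    rw [h1, ← h2]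
    congr 1
    ring

/-- Over a frame on the polygon, a compatible frame on the boundary is a map from the boundary
circle to the rotation group. -/
theorem exists_boundary_rotation {g : ℕ} (hg : 1 ≤ g) {X : OrientableS2Bundle (Surface g)}
    {F : UnitDisc → S2 → X.total} (hF : X.IsFrame (mk g) univ F) :
    ∃ τ : C(Circle, SO3), ∀ (j : Fin g) (c : Fin 2), ∀ s ∈ Icc (0 : ℝ) 1, ∀ v,
      F (boundaryPt g (4 * (j : ℕ) + (c : ℕ) + s))
          (rotate (τ (circlePt g (4 * (j : ℕ) + (c : ℕ) + s))) v) =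
        F (boundaryPt g (4 * (j : ℕ) + (c : ℕ) + 3 - s))
          (rotate (τ (circlePt g (4 * (j : ℕ) + (c : ℕ) + 3 - s))) v) := by
  have hg0 : (0 : ℝ) < g := by exact_mod_cast hg
  obtain ⟨G, hG, hGk, hGs⟩ := exists_isFrame_boundary hF
  have hper : boundaryPt g (4 * g) = boundaryPt g 0 := by
    have := circlePt_add_period hg 0
    rw [zero_add] at this
    exact Subtype.ext (congrArg (fun u : Circle => (u : ℂ)) this)
  obtain ⟨δ, hδ, hδG⟩ := (hF.comp (T := Icc 0 ((4 * g : ℕ) : ℝ)) (k := boundaryPt g)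
    (continuous_boundaryPt g).continuousOn (mapsTo_univ _ _)).exists_rotate_eq hG
    ((continuous_mk g).comp (continuous_boundaryPt g)).continuousOn
  have hδ0 : δ 0 = δ (4 * g) := by
    refine rotate_faithful fun v => (hF.fibre (boundaryPt g 0) (mem_univ _)).injective ?_
    have h1 := hδG 0 (by simp) v
    have h2 := hδG (4 * g) (by simp) v
    have e1 := hGk 0
    have e2 := hGk (4 * g)
    push_cast at e1 e2
    rw [hper] at h2
    rw [← h1, ← h2, e1, e2]
  have hcont : Continuous fun t : ℝ => δ (4 * g * Int.fract (t / (2 * Real.pi))) := by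
    have h1 : ContinuousOn (fun s : ℝ => δ (4 * g * s)) (Icc 0 1) := by
      refine hδ.comp (by fun_prop) fun s hs => ?_
      push_cast
      exact ⟨by have := hs.1; positivity, by nlinarith [hs.2]⟩
    exact h1.comp_fract'' (by simpa using hδ0) |>.comp (by fun_prop)
  obtain ⟨τ, hτ⟩ := exists_circle_of_periodic hcont (by
    intro t
    have : (t + 2 * Real.pi) / (2 * Real.pi) = t / (2 * Real.pi) + 1 := by
      have := Real.pi_ne_zero
      field_simp
    simp only [this, Int.fract_add_one])
  have hτδ : ∀ t ∈ Icc (0 : ℝ) (4 * g), τ (circlePt g t) = δ t := by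
    rintro t ⟨h0, h1⟩
    have e : 2 * Real.pi * t / (4 * g) / (2 * Real.pi) = t / (4 * g) := by
      have := Real.pi_ne_zero
      field_simp
    rw [circlePt, hτ, e]
    obtain h1 | rfl := h1.lt_or_eq
    · rw [Int.fract_eq_self.2 ⟨by positivity, by rwa [div_lt_one (by positivity)]⟩]
      congr 1
      field_simp
    · rw [div_self (by positivity), Int.fract_one, mul_zero, hδ0]
  refine ⟨τ, fun j c s hs v => ?_⟩
  have hj : ((j : ℕ) : ℝ) + 1 ≤ g := by exact_mod_cast j.2
  have hc : ((c : ℕ) : ℝ) ≤ 1 := by exact_mod_cast Nat.lt_succ_iff.1 c.2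
  have hj0 : (0 : ℝ) ≤ ((j : ℕ) : ℝ) := by positivity
  have hc0 : (0 : ℝ) ≤ ((c : ℕ) : ℝ) := by positivity
  have m1 : (4 * (j : ℕ) + (c : ℕ) + s : ℝ) ∈ Icc (0 : ℝ) (4 * g) :=
    ⟨by linarith [hs.1], by linarith [hs.2]⟩
  have m2 : (4 * (j : ℕ) + (c : ℕ) + 3 - s : ℝ) ∈ Icc (0 : ℝ) (4 * g) :=
    ⟨by linarith [hs.2], by linarith [hs.1]⟩
  rw [hτδ _ m1, hτδ _ m2]
  have h1 := hδG _ (by push_cast; exact m1) v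
  have h2 := hδG _ (by push_cast; exact m2) v
  rw [← h1, ← h2, hGs j c s hs]

namespace Surface

variable (g : ℕ)

/-- The point of the polygon that represents a point of the surface inside the polygon. -/
noncomputable def pos (x : Surface g) : UnitDisc :=
  discRetract (((1 - radius x : ℝ) : ℂ)⁻¹ * direction g x)

theorem pos_mk {z : UnitDisc} (hz : ‖z.1‖ < 1) : pos g (mk g z) = z := by
  have h : ((1 - ‖z.1‖ : ℝ) : ℂ) ≠ 0 := by exact_mod_cast (sub_pos.2 hz).ne'
  conv_rhs => rw [← discRetract_coe z]
  rw [pos, radius_mk]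
  congr 1
  exact inv_mul_cancel_left₀ h _

theorem mk_pos {x : Surface g} (hx : radius x < 1) : mk g (pos g x) = x := by
  obtain ⟨z, rfl⟩ := Quot.exists_rep x
  exact congrArg (mk g) (pos_mk g hx)

theorem continuousOn_pos : ContinuousOn (pos g) (H2 g) := by
  refine continuous_discRetract.comp_continuousOn (ContinuousOn.mul (ContinuousOn.inv₀ ?_ ?_)
    (continuous_direction g).continuousOn)
  · exact (Complex.continuous_ofReal.comp (continuous_const.sub continuous_radius)).continuousOn
  · intro x hx
    have : radius x ≤ 1 / 2 := hx
    exact_mod_cast (show (0 : ℝ) < 1 - radius x by linarith).ne'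

end Surface

/-- The direction of a point of the polygon from the centre. -/
noncomputable def dir (z : UnitDisc) : Circle := Circle.exp z.1.arg

theorem norm_mul_dir (z : UnitDisc) : (‖z.1‖ : ℂ) * dir z = z.1 := by
  rw [dir, Circle.coe_exp, Complex.norm_mul_exp_arg_mul_I]

theorem continuousOn_dir : ContinuousOn dir {z | 0 < ‖z.1‖} := by
  have hind : Topology.IsInducing ((↑) : Circle → ℂ) := ⟨rfl⟩
  refine hind.continuousOn_iff.2 ?_
  have hc : ContinuousOn (fun z : UnitDisc => z.1 / (‖z.1‖ : ℂ)) {z | 0 < ‖z.1‖} := by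
    refine ContinuousOn.div (by fun_prop) (by fun_prop) fun z hz => ?_
    exact_mod_cast (show 0 < ‖z.1‖ from hz).ne'
  refine hc.congr fun z hz => ?_
  have hz' : (‖z.1‖ : ℂ) ≠ 0 := by exact_mod_cast (show 0 < ‖z.1‖ from hz).ne'
  change (dir z : ℂ) = z.1 / (‖z.1‖ : ℂ)
  rw [eq_div_iff hz', mul_comm, norm_mul_dir]

theorem dir_eq {z : UnitDisc} {r : ℝ} (hr : 0 < r) {u : Circle} (h : z.1 = r * u) :
    dir z = u := by
  have hn : ‖z.1‖ = r := by
    rw [h, norm_mul, Circle.norm_coe, mul_one, Complex.norm_real, Real.norm_of_nonneg hr.le]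
  have h1 := norm_mul_dir z
  rw [hn, h] at h1
  exact Subtype.ext (mul_left_cancel₀ (by exact_mod_cast hr.ne') h1)

/-- A bundle is given, up to isomorphism, by a map `τ` from the circle to the rotation group, and
it is the clutched bundle of every `φ` for which `τ φ` is even. -/
theorem exists_forall_iso_clutchedBundle {g : ℕ} (hg : 1 ≤ g) (X : OrientableS2Bundle (Surface g)) :
    ∃ τ : C(Circle, SO3), ∀ φ : C(Circle, SO3), EvenLoop (fun u => τ u * φ u) →
      Iso X (clutchedBundle g φ) := by
  obtain ⟨F, hF⟩ := exists_isFrame_disc (X := X) (continuous_mk g)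
  obtain ⟨τ, hτ⟩ := exists_boundary_rotation hg hF
  refine ⟨τ, fun φ hφ => ?_⟩
  obtain ⟨E, hE, hEu⟩ := hφ.exists_extension
  -- Near the boundary the frame is corrected by `τ`, constantly along the radii, so that it
  -- descends to the surface.
  have hF₁ : X.IsFrame (mk g) {z | 0 < ‖z.1‖} fun z v => F z (rotate (τ (dir z)) v) :=
    (hF.mono (subset_univ _)).rotate (continuous_mk g).continuousOn
      (τ.continuous.comp_continuousOn continuousOn_dir)
  let F₁ : Surface g → S2 → X.total := Quot.lift (fun z v => F z (rotate (τ (dir z)) v)) (by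
    rintro z w ⟨j, c, s, hs, hz, hw⟩
    funext v
    have dz : dir z = circlePt g (4 * (j : ℕ) + (c : ℕ) + s) :=
      dir_eq one_pos (by rw [hz]; simp)
    have dw : dir w = circlePt g (4 * (j : ℕ) + (c : ℕ) + 3 - s) :=
      dir_eq one_pos (by rw [hw]; simp)
    have ez : z = boundaryPt g (4 * (j : ℕ) + (c : ℕ) + s) := Subtype.ext hz
    have ew : w = boundaryPt g (4 * (j : ℕ) + (c : ℕ) + 3 - s) := Subtype.ext hw
    simp only [dz, dw]
    rw [ez, ew]
    exact hτ j c s hs v)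
  have h₁ : X.IsFrame id (H01 g) F₁ := by
    have hU : IsOpen {x : Surface g | 0 < radius x} := isOpen_lt continuous_const continuous_radius
    have hq : Topology.IsQuotientMap (mk g) := isQuotientMap_quot_mk
    refine IsFrame.mono (S := {x | 0 < radius x}) ⟨fun x hx => ?_, fun v => ?_⟩ fun x hx =>
      lt_of_lt_of_le (by norm_num) (show 1 / 2 ≤ radius x from hx)
    · obtain ⟨z, rfl⟩ := Quot.exists_rep x
      exact hF₁.fibre z hx
    · exact (hq.continuousOn_isOpen_iff hU).2 (hF₁.continuousOn v)
  have h₂ : X.IsFrame id (H2 g) fun x v => F (pos g x) (rotate (E (2 * (pos g x).1)) v) := by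
    have h := hF.comp (continuousOn_pos g) (mapsTo_univ _ _)
    refine (h.rotate ((continuous_mk g).comp_continuousOn (continuousOn_pos g))
      (δ := fun x => E (2 * (pos g x).1)) (hE.comp_continuousOn ?_)).congr (fun x hx => ?_)
      fun _ _ => rfl
    · exact continuousOn_const.mul (continuous_subtype_val.comp_continuousOn (continuousOn_pos g))
    · exact (mk_pos g (lt_of_le_of_lt (show radius x ≤ 1 / 2 from hx) (by norm_num))).symm
  refine iso_clutchedBundle h₁ h₂ fun u v => ?_
  obtain ⟨z, hz, hzu⟩ : ∃ z : UnitDisc, attach g u = mk g z ∧ z.1 = (u : ℂ) / 2 := ⟨_, rfl, rfl⟩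
  have hn : ‖z.1‖ < 1 := by
    rw [hzu, norm_div, Circle.norm_coe]
    norm_num
  have hd : dir z = u := dir_eq (r := 1 / 2) (by norm_num) (by rw [hzu]; push_cast; ring)
  have h2z : 2 * z.1 = u := by rw [hzu]; ring
  simp only [hz, pos_mk g hn, h2z]
  change F z (rotate (τ (dir z)) (rotate (φ u) v)) = _
  rw [hd, ← rotate_mul, hEu]

theorem iso_product_or_clutchedBundle {g : ℕ} (hg : 1 ≤ g) {φ : C(Circle, SO3)}
    (hφ : ¬ EvenLoop φ) (X : OrientableS2Bundle (Surface g)) :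
    Iso X (product (Surface g)) ∨ Iso X (clutchedBundle g φ) := by
  obtain ⟨τ, hτ⟩ := exists_forall_iso_clutchedBundle hg X
  by_cases h : EvenLoop τ
  · left
    refine (hτ 1 ?_).trans (product_iso_clutchedBundle_one g).symm
    simpa using h
  · exact Or.inr (hτ φ (.mul_of_not τ.continuous φ.continuous h hφ))

theorem lemma1p2 (g : ℕ) (hg : 1 ≤ g) :
    Nonempty (FundamentalGroup SO3 1 ≃* Multiplicative (ZMod 2)) ∧
    (∀ φ : C(Circle, SO3), loopClass φ ≠ 1 →
      ¬ OrientableS2Bundle.FibreHomeomorphic (clutchedBundle g φ)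
        (OrientableS2Bundle.product (Surface g))) ∧
    (∀ φ : C(Circle, SO3), loopClass φ ≠ 1 → ∀ X : OrientableS2Bundle (Surface g),
      OrientableS2Bundle.Iso X (OrientableS2Bundle.product (Surface g)) ∨
      OrientableS2Bundle.Iso X (clutchedBundle g φ)) ∧
    Nat.card (OrientableS2Bundle.IsoClasses (Surface g)) = 2 := by
  have h2 : ∀ φ : C(Circle, SO3), loopClass φ ≠ 1 →
      ¬ FibreHomeomorphic (clutchedBundle g φ) (product (Surface g)) := fun φ hφ h =>
    hφ ((loopClass_eq_one_iff φ).2 (evenLoop_of_fibreHomeomorphic hg φ h))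
  have h3 : ∀ φ : C(Circle, SO3), loopClass φ ≠ 1 → ∀ X : OrientableS2Bundle (Surface g),
      Iso X (product (Surface g)) ∨ Iso X (clutchedBundle g φ) := fun φ hφ =>
    iso_product_or_clutchedBundle hg fun h => hφ ((loopClass_eq_one_iff φ).2 h)
  refine ⟨nonempty_fundamentalGroup_SO3, h2, h3, ?_⟩
  obtain ⟨φ, hφ⟩ := exists_loopClass_ne_one
  let q : OrientableS2Bundle (Surface g) → IsoClasses (Surface g) :=
    Quotient.mk (isoSetoid (Surface g))
  refine Nat.card_eq_two_iff.2 ⟨q (product (Surface g)), q (clutchedBundle g φ), fun h => ?_, ?_⟩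
  · obtain ⟨Ψ, hΨ, -⟩ := Iso.symm (Quotient.exact h)
    exact h2 φ hφ ⟨Ψ, hΨ⟩
  · refine eq_univ_of_forall fun c => ?_
    obtain ⟨X, rfl⟩ := Quotient.exists_rep c
    exact (h3 φ hφ X).imp (fun h => Quotient.sound h) fun h => Quotient.sound h
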